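/- **The $k$-cop-move game.** Let $G$ be a graph. In the $k$-cop-move game with $c$ cops on $G$, the cops' player first places $c$ cops on vertices of $G$, then the other player places the robber on a vertex. After that the two players alternate, the cops moving first. On the cops' turn at most $k$ of the cops are moved, each along one edge; on the robber's turn the robber stays or moves along one edge. All positions are always known to both players. The cops win if at some moment a cop and the robber are on the same vertex; otherwise the robber wins. The $k$-cop-move number $\mathrm{cop}_k(G)$ is the least $c$ for which the cops have a winning strategy. **The graph $\mathbb G$.** Let $B$ be the truncated icosahedron, with $60$ vertices, $90$ edges, $12$ pentagonal and $20$ hexagonal faces. The graph $\mathbb G$ has the $60$ vertices of $B$ as its *key vertices*; the edges of $B$ are not kept. Further vertices and edges are drawn inside the faces of $B$ as follows. 1. For every face $\varphi$ and every side $vw$ of $\varphi$, with ends $v,w$, there is a path of length $4$ in $\varphi$ from $v$ to $w$, with three new inner vertices: $v,\ p_{\varphi,vw},\ m_{\varphi,vw},\ p_{\varphi,wv},\ w$. 2. For every face $\varphi$ and every vertex $v$ of $\varphi$, with neighbours $w,w'$ along the boundary of $\varphi$, the vertices $p_{\varphi,vw}$ and $p_{\varphi,vw'}$ are adjacent. 3.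 For every edge $vw$ of $B$, lying on the two faces $\varphi,\varphi'$, the vertices $m_{\varphi,vw}$ and $m_{\varphi',vw}$ are adjacent. 4. Every hexagonal face $\varphi$ shares three of its sides with pentagons. For each such side $s$ there are two new vertices $e_{\varphi,s}$ and $z_{\varphi,s}$ in $\varphi$, and $m_{\varphi,s},e_{\varphi,s},z_{\varphi,s}$ is a path; the three vertices $z_{\varphi,s}$ form a triangle in the centre of $\varphi$. So there are $15$ new vertices in each pentagon and $24$ in each hexagon. **Theorem.** The graph $\mathbb G$ has $60+12\cdot 15+20\cdot 24=720$ vertices. The robber has a winning strategy in the $1$-cop-move game with $3$ cops on $\mathbb G$, and $\mathrm{cop}_1(\mathbb G)>3$. -/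

import Mathlib

/-! ### The one-cop-move game and its relatives -/

namespace CopsRobber

variable {V : Type*}

/-- A legal turn of the cops in the `k`-cop-move game with `c` cops: every cop stays where it is or
moves along an edge, and at most `k` cops move. -/
def CopStep (G : SimpleGraph V) (k : ℕ) {c : ℕ} (p q : Fin c → V) : Prop :=
  (∀ i, q i = p i ∨ G.Adj (p i) (q i)) ∧ {i | q i ≠ p i}.ncard ≤ k

/-- A legal turn of the robber: stay, or move along an edge. -/
def RobberStep (G : SimpleGraph V) (r s : V) : Prop :=
  s = r ∨ G.Adj r s

/-- A play is given by the cops' positions `C 0, C 1, …` (`C 0` is the initial placement) and the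
robber's positions `R 0, R 1, …` (`R 0` is the initial placement), in the order
`C 0, R 0, C 1, R 1, …`.  The robber is caught if at some moment a cop stands on the robber's
vertex, either after a turn of the robber or after a turn of the cops. -/
def Caught {c : ℕ} (C : ℕ → Fin c → V) (R : ℕ → V) : Prop :=
  ∃ n i, C n i = R n ∨ C (n + 1) i = R n

/-- The cops have a winning strategy in the `k`-cop-move game with `c` cops on `G`.  A strategy
`S` prescribes the cops' `n`-th configuration from the robber's positions so far. -/
def CopsWin (G : SimpleGraph V) (k c : ℕ) : Prop :=
  ∃ S : (n : ℕ) → (Fin n → V) → Fin c → V,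
    ∀ R : ℕ → V, (∀ n, RobberStep G (R n) (R (n + 1))) →
      (∀ n, CopStep G k (S n fun j => R j) (S (n + 1) fun j => R j)) ∧
        Caught (fun n => S n fun j => R j) R

/-- The robber has a winning strategy in the `k`-cop-move game with `c` cops on `G`: a rule `T`
prescribing the robber's `n`-th position from the cops' configurations so far, which is legal and
evades capture forever. -/
def RobberWins (G : SimpleGraph V) (k c : ℕ) : Prop :=
  ∃ T : (n : ℕ) → (Fin (n + 1) → Fin c → V) → V,
    ∀ C : ℕ → Fin c → V, (∀ n, CopStep G k (C n) (C (n + 1))) →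
      (∀ n, RobberStep G (T n fun j => C j) (T (n + 1) fun j => C j)) ∧
        ¬ Caught C (fun n => T n fun j => C j)

/-- The `k`-cop-move number of `G`: the least number of cops with a winning strategy
(`⊤` if there is none). -/
noncomputable def copNumber (G : SimpleGraph V) (k : ℕ) : ℕ∞ :=
  ⨅ (c : ℕ) (_ : CopsWin G k c), (c : ℕ∞)

end CopsRobber

/-! ### The truncated icosahedron -/

namespace Soccer

/-- The twelve vertices of the icosahedron: `(b, none)` are the two poles, and `(b, some i)` are the
five vertices of the ring around the pole `(b, none)`. -/
abbrev Ico : Type := Bool × Option (ZMod 5)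

/-- The icosahedron: each pole is joined to its ring, each ring is a 5-cycle, and between the rings
runs a zigzag. -/
def icosahedron : SimpleGraph Ico :=
  SimpleGraph.fromRel fun x y =>
    match x, y with
    | (b, none), (b', some _) => b = b'
    | (true, some i), (true, some j) => j = i + 1
    | (false, some i), (false, some j) => j = i + 1
    | (true, some i), (false, some j) => j = i ∨ j = i + 1
    | _, _ => False

/-- A triangular face of the icosahedron (its 3-cliques are exactly its faces). -/
abbrev Triangle : Type := {t : Finset Ico // icosahedron.IsNClique 3 t}

/-- A vertex of the truncated icosahedron: the dart `i → j` of the icosahedron stands for the vertex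
on the edge `ij` near its end `i`. -/
abbrev BVertex : Type := icosahedron.Dart

/-- The truncated icosahedron: a vertex is joined to the other vertex on the same edge of the
icosahedron, and to its two neighbours around the same (cut off) corner. -/
def B : SimpleGraph BVertex where
  Adj d e := e = d.symm ∨ (d.fst = e.fst ∧ icosahedron.Adj d.snd e.snd)
  symm := ⟨by
    rintro d e (rfl | ⟨h, h'⟩)
    · exact Or.inl (SimpleGraph.Dart.symm_symm d).symm
    · exact Or.inr ⟨h.symm, h'.symm⟩⟩
  loopless := ⟨by
    rintro d (h | ⟨-, h⟩)
    · exact SimpleGraph.Dart.symm_ne d h.symm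
    · exact icosahedron.loopless.irrefl _ h⟩

/-- The faces of the truncated icosahedron: a pentagon for every vertex and a hexagon for every
triangle of the icosahedron. -/
inductive Face : Type
  | pentagon (i : Ico)
  | hexagon (t : Triangle)

/-- The vertices on the boundary of a face: around the pentagon `i` lie the darts that start at `i`,
and around the hexagon `t` lie the six darts inside `t`. -/
def Face.verts : Face → Set BVertex
  | .pentagon i => {d | d.fst = i}
  | .hexagon t => {d | d.fst ∈ t.1 ∧ d.snd ∈ t.1}

/-- The edge `s` of the truncated icosahedron is a side of the face `φ`. -/
def Face.IsSide (φ : Face) (s : Sym2 BVertex) : Prop :=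
  s ∈ B.edgeSet ∧ ∀ v ∈ s, v ∈ φ.verts

/-- A directed side of a face: a face `φ` and an edge of `φ` directed from `v` to `w`. -/
structure DirSide : Type where
  face : Face
  dart : B.Dart
  isSide : face.IsSide dart.edge

/-- A side of a face: a face and an edge on its boundary.  Every edge is a side of two faces. -/
structure Side : Type where
  face : Face
  edge : Sym2 BVertex
  isSide : face.IsSide edge

/-- A side of a hexagon `t` that the hexagon shares with a pentagon. -/
structure HexPentSide : Type where
  hex : Triangle
  edge : Sym2 BVertex
  isSide : (Face.hexagon hex).IsSide edge
  shared : ∃ i, (Face.pentagon i).IsSide edge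

/-! ### The graph -/

/-- The vertices of the graph.
* `key v`: the vertices of the truncated icosahedron;
* `corner` and `mid`: each side `vw` of each face `φ` is replaced, inside `φ`, by a path
  `key v, corner (φ, v → w), mid (φ, vw), corner (φ, w → v), key w` of length four;
* `spoke` and `center`: inside each hexagon, for each of the three sides `vw` shared with a pentagon,
  a path `mid, spoke, center` leads from the middle of that side to one of the three
  central vertices. -/
inductive Vertex : Type
  | key (v : BVertex)
  | corner (a : DirSide)
  | mid (s : Side)
  | spoke (h : HexPentSide)
  | center (h : HexPentSide)

/-- The edges of the graph, each listed in at least one direction. -/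
inductive Link : Vertex → Vertex → Prop
  /-- The key vertex `v` and the corner vertex next to it on a side of a face. -/
  | key_corner (a : DirSide) : Link (.key a.dart.fst) (.corner a)
  /-- The two corner vertices at the same key vertex in the same face. -/
  | corner_corner (a b : DirSide) (hf : a.face = b.face) (hv : a.dart.fst = b.dart.fst)
      (hne : a ≠ b) : Link (.corner a) (.corner b)
  /-- A corner vertex and the middle of its side. -/
  | corner_mid (a : DirSide) (s : Side) (hf : a.face = s.face) (he : a.dart.edge = s.edge) :
      Link (.corner a) (.mid s)
  /-- The two middles belonging to the same edge, one in each of the two faces at that edge. -/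
  | mid_mid (s s' : Side) (he : s.edge = s'.edge) (hne : s ≠ s') : Link (.mid s) (.mid s')
  /-- From the middle of a side of a hexagon along a pentagon into the hexagon. -/
  | mid_spoke (h : HexPentSide) : Link (.mid ⟨.hexagon h.hex, h.edge, h.isSide⟩) (.spoke h)
  /-- On to the central vertex of the hexagon facing that side. -/
  | spoke_center (h : HexPentSide) : Link (.spoke h) (.center h)
  /-- The three central vertices of a hexagon form a triangle. -/
  | center_center (h h' : HexPentSide) (hx : h.hex = h'.hex) (hne : h ≠ h') :
      Link (.center h) (.center h')

/-- The graph `𝔾`. -/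
def graph : SimpleGraph Vertex := SimpleGraph.fromRel Link

end Soccer

/-!
The key vertices serve as havens. A robber on a haven with no cop next to it just stays; as the cops
move one at a time, at most one cop threatens him when it is his turn. He then runs to another
haven, where again at most one cop threatens him on arrival. A run along a fixed route succeeds
unless some cop starts close enough to intercept it, and if the cops control all good routes, then
a few well-chosen moves unblock one of them. The symmetries of the truncated icosahedron act
transitively on the pairs of a haven and an orientation, so that only the three kinds of corners
from which the threat can come have to be distinguished. This leaves a finite check over the
positions of the other two cops, where one cop is enumerated and the other is handled through sets
of positions, encoded as bit masks. Instead of automorphisms of the graph, numberings of its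
vertices are used: each pair of a haven and an orientation determines one, and in all of them the
graph has the same neighbour lists.
-/

namespace CopsRobber

section Game

variable {V : Type*} {G : SimpleGraph V} {k c : ℕ}

theorem RobberStep.symm {r s : V} (h : RobberStep G r s) : RobberStep G s r :=
  h.imp Eq.symm SimpleGraph.Adj.symm

theorem CopStep.refl (C : Fin c → V) : CopStep G k C C := ⟨fun _ => Or.inl rfl, by simp⟩

theorem CopStep.comp_perm {C C' : Fin c → V} (h : CopStep G k C C') (σ : Equiv.Perm (Fin c)) :
    CopStep G k (C ∘ σ) (C' ∘ σ) := by
  refine ⟨fun i => h.1 (σ i), ?_⟩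
  have moved : {i | (C' ∘ σ) i ≠ (C ∘ σ) i} = σ ⁻¹' {i | C' i ≠ C i} := rfl
  rw [moved, Set.ncard_preimage_of_injective_subset_range σ.injective (by simp)]
  exact h.2

theorem CopStep.ncard_adj_le {C C' : Fin c → V} (h : CopStep G k C C') {x : V}
    (hC : ∀ i, ¬ G.Adj x (C i)) : {i | G.Adj x (C' i)}.ncard ≤ k :=
  (Set.ncard_le_ncard (fun i (hi : G.Adj x (C' i)) (heq : C' i = C i) => hC i (heq ▸ hi))
    (Set.toFinite _)).trans h.2

theorem robberWins_of_invariant (I : V → (Fin c → V) → Prop)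
    (not_caught : ∀ r C, I r C → ∀ i, C i ≠ r)
    (start : ∀ C : Fin c → V, ∃ r, (∀ i, C i ≠ r) ∧ ∀ C', CopStep G k C C' → I r C')
    (step : ∀ r C, I r C → ∃ s, RobberStep G r s ∧ (∀ i, C i ≠ s) ∧
      ∀ C', CopStep G k C C' → I s C') : RobberWins G k c := by
  classical
  choose first hfirst using start
  choose! move hmove using step
  let T : (n : ℕ) → (Fin (n + 1) → Fin c → V) → V := fun n =>
    Nat.rec (motive := fun n => (Fin (n + 1) → Fin c → V) → V) (fun C => first (C 0))
      (fun n Tn C => move (Tn fun j => C j.castSucc) (C (Fin.last _))) n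
  refine ⟨T, fun C hC => ?_⟩
  have invariant (n : ℕ) : (∀ i, C n i ≠ T n fun j => C j) ∧
      ∀ C', CopStep G k (C n) C' → I (T n fun j => C j) C' := by
    induction n with
    | zero => exact hfirst (C 0)
    | succ n ih => exact (hmove _ _ (ih.2 _ (hC n))).2
  refine ⟨fun n => (hmove _ _ ((invariant n).2 _ (hC n))).1, ?_⟩
  rintro ⟨n, i, h | h⟩
  · exact (invariant n).1 i h
  · exact not_caught _ _ ((invariant n).2 _ (hC n)) i h

theorem exists_play (S : (n : ℕ) → (Fin n → V) → Fin c → V)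
    (T : (n : ℕ) → (Fin (n + 1) → Fin c → V) → V) :
    ∃ (C : ℕ → Fin c → V) (R : ℕ → V),
      (∀ n, C n = S n fun j => R j) ∧ ∀ n, R n = T n fun j => C j := by
  let R : ℕ → V := Nat.lt_wfRel.wf.fix fun n R =>
    T n fun j => S j fun i => R i (i.2.trans_le (Nat.lt_succ_iff.1 j.2))
  exact ⟨fun n => S n fun j => R j, R, fun _ => rfl, fun n => Nat.lt_wfRel.wf.fix_eq _ n⟩

/-- A player who answers legally to every legal sequence of the opponent also answers legally as
long as the opponent has been legal so far: let the opponent stop moving at time `N`. -/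
theorem step_of_forall_lt_step {α β : Type*} {P : α → α → Prop} {Q : β → β → Prop}
    (refl : ∀ a, P a a) {F : ℕ → (ℕ → α) → β}
    (legal : ∀ u, (∀ m, P (u m) (u (m + 1))) → ∀ m, Q (F m u) (F (m + 1) u)) {n N : ℕ}
    (causal : ∀ m ≤ n + 1, ∀ u v, (∀ j ≤ N, u j = v j) → F m u = F m v) {u : ℕ → α}
    (hu : ∀ m < N, P (u m) (u (m + 1))) : Q (F n u) (F (n + 1) u) := by
  have stopped (m : ℕ) : P (u (min m N)) (u (min (m + 1) N)) := by
    rcases lt_or_ge m N with hm | hm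
    · rw [min_eq_left hm.le, min_eq_left (Nat.succ_le_of_lt hm)]
      exact hu m hm
    · rw [min_eq_right hm, min_eq_right (hm.trans (Nat.le_succ m))]
      exact refl _
  have agree (j : ℕ) (hj : j ≤ N) : u j = u (min j N) := by rw [min_eq_left hj]
  rw [causal n (Nat.le_succ n) u _ agree, causal (n + 1) le_rfl u _ agree]
  exact legal _ stopped n

theorem RobberWins.not_copsWin (h : RobberWins G k c) : ¬ CopsWin G k c := by
  rintro ⟨S, hS⟩
  obtain ⟨T, hT⟩ := h
  obtain ⟨C, R, hC, hR⟩ := exists_play S T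
  have cops_legal (n : ℕ) (h : ∀ m < n, RobberStep G (R m) (R (m + 1))) :
      CopStep G k (C n) (C (n + 1)) := by
    rw [hC, hC]
    exact step_of_forall_lt_step (P := RobberStep G) (F := fun n u => S n fun j => u j)
      (fun _ => Or.inl rfl)
      (fun u hu => (hS u hu).1)
      (fun m hm u v huv => congrArg (S m) (funext fun j => huv j (by omega))) h
  have robber_legal (n : ℕ) (h : ∀ m < n + 1, CopStep G k (C m) (C (m + 1))) :
      RobberStep G (R n) (R (n + 1)) := by
    rw [hR, hR]
    exact step_of_forall_lt_step (P := CopStep G k) (F := fun n u => T n fun j => u j)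
      CopStep.refl
      (fun u hu => (hT u hu).1)
      (fun m hm u v huv => congrArg (T m) (funext fun j => huv j (by omega))) h
  have legal (n : ℕ) : CopStep G k (C n) (C (n + 1)) ∧ RobberStep G (R n) (R (n + 1)) := by
    induction n using Nat.strong_induction_on with
    | _ n ih =>
      have hn := cops_legal n fun m hm => (ih m hm).2
      refine ⟨hn, robber_legal n fun m hm => ?_⟩
      rcases Nat.lt_succ_iff_lt_or_eq.1 hm with hm | rfl
      exacts [(ih m hm).1, hn]
  have caught : Caught C R := by simpa only [← hC] using (hS R fun n => (legal n).2).2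
  have not_caught : ¬ Caught C R := by simpa only [← hR] using (hT C fun n => (legal n).1).2
  exact not_caught caught

theorem RobberWins.mono {c' : ℕ} [Nonempty V] (h : RobberWins G k c) (hc : c' ≤ c) :
    RobberWins G k c' := by
  obtain ⟨T, hT⟩ := h
  let park : (Fin c' → V) → Fin c → V := fun C i =>
    if h : i.1 < c' then C ⟨i, h⟩ else Classical.arbitrary V
  have park_castLE (C i) : park C (Fin.castLE hc i) = C i := by simp [park]
  have copStep_park {C C' : Fin c' → V} (hstep : CopStep G k C C') :
      CopStep G k (park C) (park C') := by
    refine ⟨fun i => ?_, le_trans ?_ hstep.2⟩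
    · by_cases h : i.1 < c'
      · simpa [park, h] using hstep.1 ⟨i, h⟩
      · simp [park, h]
    · refine (Set.ncard_le_ncard (fun i hi => ?_) (Set.toFinite _)).trans
        (Set.ncard_image_le (f := Fin.castLE hc) (Set.toFinite _))
      by_cases h : i.1 < c'
      · exact ⟨⟨i, h⟩, by simpa [park, h] using hi, rfl⟩
      · simp [park, h] at hi
  refine ⟨fun n C => T n fun j => park (C j), fun C hC => ?_⟩
  obtain ⟨legal, not_caught⟩ := hT (fun n => park (C n)) fun n => copStep_park (hC n)
  refine ⟨legal, ?_⟩
  rintro ⟨n, i, h⟩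
  exact not_caught ⟨n, Fin.castLE hc i, by simpa only [park_castLE] using h⟩

theorem RobberWins.lt_copNumber [Nonempty V] (h : RobberWins G k c) : c < copNumber G k := by
  have lower : ((c + 1 : ℕ) : ℕ∞) ≤ copNumber G k := le_iInf₂ fun c' hc' => by
    by_contra hlt
    exact (h.mono (Nat.lt_succ_iff.1 (by exact_mod_cast not_le.1 hlt))).not_copsWin hc'
  exact lt_of_lt_of_le (by exact_mod_cast Nat.lt_succ_self c) lower

end Game

section Havens

variable {V : Type*} {G : SimpleGraph V} {k c : ℕ} {K : Set V} {x y : V} {C : Fin c → V}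

/-- The robber, who is to move at `x` against the cops at `C`, can force his way to a haven (a
vertex of `K`) that is neither occupied nor threatened by more than `k` cops. -/
inductive Escapes (G : SimpleGraph V) (k : ℕ) (K : Set V) {c : ℕ} : V → (Fin c → V) → Prop
  | arrived {x : V} {C : Fin c → V} (hx : x ∈ K) (hC : ∀ i, C i ≠ x)
      (threats : {i | G.Adj x (C i)}.ncard ≤ k) : Escapes G k K x C
  | move {x y : V} {C : Fin c → V} (hC : ∀ i, C i ≠ x) (hxy : RobberStep G x y)
      (hy : ∀ i, C i ≠ y) (next : ∀ C', CopStep G k C C' → Escapes G k K y C') : Escapes G k K x C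

/-- The robber, who is to move at `x` against the cops at `C`, has a move after which he
`Escapes`. -/
def Advances (G : SimpleGraph V) (k : ℕ) (K : Set V) {c : ℕ} (x : V) (C : Fin c → V) : Prop :=
  ∃ y, RobberStep G x y ∧ (∀ i, C i ≠ y) ∧ ∀ C', CopStep G k C C' → Escapes G k K y C'

theorem Escapes.ne (h : Escapes G k K x C) : ∀ i, C i ≠ x := by
  cases h <;> assumption

theorem Advances.escapes (h : Advances G k K x C) (hC : ∀ i, C i ≠ x) : Escapes G k K x C :=
  let ⟨_, hxy, hy, next⟩ := h
  .move hC hxy hy next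

theorem Escapes.comp_perm (h : Escapes G k K x C) (σ : Equiv.Perm (Fin c)) :
    Escapes G k K x (C ∘ σ) := by
  induction h with
  | @arrived x C hx hC threats =>
    refine .arrived hx (fun i => hC (σ i)) ?_
    have preimage : {i | G.Adj x ((C ∘ σ) i)} = σ ⁻¹' {i | G.Adj x (C i)} := rfl
    rwa [preimage, Set.ncard_preimage_of_injective_subset_range σ.injective (by simp)]
  | move hC hxy hy _ ih =>
    refine .move (fun i => hC (σ i)) hxy (fun i => hy (σ i)) fun C' hC' => ?_
    simpa [Function.comp_assoc] using
      ih (C' ∘ σ.symm) (by simpa [Function.comp_assoc] using hC'.comp_perm σ.symm)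

theorem Advances.comp_perm (h : Advances G k K x C) (σ : Equiv.Perm (Fin c)) :
    Advances G k K x (C ∘ σ) := by
  obtain ⟨y, hxy, hy, next⟩ := h
  refine ⟨y, hxy, fun i => hy (σ i), fun C' hC' => ?_⟩
  simpa [Function.comp_assoc] using
    (next (C' ∘ σ.symm)
      (by simpa [Function.comp_assoc] using hC'.comp_perm σ.symm)).comp_perm σ

theorem escapes_of_copStep (hx : x ∈ K) (hC : ∀ i, ¬ RobberStep G x (C i)) {C' : Fin c → V}
    (h : CopStep G k C C') : Escapes G k K x C' := by
  refine .arrived hx (fun i hi => ?_) (h.ncard_adj_le fun i => hC i ∘ Or.inr)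
  rcases h.1 i with heq | hadj
  · exact hC i (.inl (heq.symm.trans hi))
  · exact hC i (.inr (hi ▸ hadj).symm)

theorem robberWins_of_havens
    (start : ∀ C : Fin c → V, ∃ x ∈ K, ∀ i, ¬ RobberStep G x (C i))
    (advance : ∀ x ∈ K, ∀ C : Fin c → V, (∀ i, C i ≠ x) → {i | G.Adj x (C i)}.ncard ≤ k →
      (∃ i, G.Adj x (C i)) → Advances G k K x C) : RobberWins G k c := by
  refine robberWins_of_invariant (Escapes G k K) (fun x C h => h.ne) (fun C => ?_) fun x C h => ?_
  · obtain ⟨x, hx, hC⟩ := start C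
    exact ⟨x, fun i hi => hC i (.inl hi), fun C' => escapes_of_copStep hx hC⟩
  · cases h with
    | move hC hxy hy next => exact ⟨_, hxy, hy, next⟩
    | arrived hx hC threats =>
      by_cases threatened : ∃ i, G.Adj x (C i)
      · exact advance x hx C hC threats threatened
      · refine ⟨x, .inl rfl, hC, fun C' => escapes_of_copStep hx fun i hi => ?_⟩
        exact hi.elim (hC i) fun h => threatened ⟨i, h⟩

/-- The closed neighbourhood of a set of vertices. -/
def closedNhd (G : SimpleGraph V) (Z : Set V) : Set V := {v | ∃ w ∈ Z, RobberStep G v w}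

theorem subset_closedNhd (Z : Set V) : Z ⊆ closedNhd G Z := fun v hv => ⟨v, hv, .inl rfl⟩

theorem ne_of_copStep {C C' : Fin c → V} (h : CopStep G k C C')
    (hC : ∀ i, C i ∉ closedNhd G {y}) (i : Fin c) : C' i ≠ y :=
  fun hi => hC i ⟨_, rfl, hi ▸ h.1 i⟩

/-- The robber, who is to move at `x`, can run to a haven if all `c` cops are outside `Z`. -/
def CanRun (G : SimpleGraph V) (k c : ℕ) (K : Set V) (x : V) (Z : Set V) : Prop :=
  ∀ C : Fin c → V, (∀ i, C i ∉ Z) → Advances G k K x C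

theorem CanRun.mono {Z Z' : Set V} (h : CanRun G k c K x Z) (hZ : Z ⊆ Z') :
    CanRun G k c K x Z' :=
  fun C hC => h C fun i hi => hC i (hZ hi)

theorem canRun_closedNhd_singleton (hxy : RobberStep G x y) (hy : y ∈ K) :
    CanRun G k c K x (closedNhd G {y}) := fun _ hC =>
  ⟨y, hxy, fun i hi => hC i (subset_closedNhd _ hi), fun _ =>
    escapes_of_copStep hy fun i hi => hC i ⟨y, rfl, hi.symm⟩⟩

theorem CanRun.cons {Z : Set V} (hxy : RobberStep G x y) (h : CanRun G k c K y Z) :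
    CanRun G k c K x (closedNhd G {y} ∪ closedNhd G Z) := fun _ hC =>
  ⟨y, hxy, fun i hi => hC i (.inl (subset_closedNhd _ hi)), fun C' hC' =>
    (h C' fun i hi => hC i (.inr ⟨_, hi, hC'.1 i⟩)).escapes
      (ne_of_copStep hC' fun i hi => hC i (.inl hi))⟩

theorem CopStep.exists_update {C C' : Fin c → V} (h : CopStep G 1 C C') :
    C' = C ∨ ∃ i v, G.Adj (C i) v ∧ C' = Function.update C i v := by
  have unique := (Set.ncard_le_one (Set.toFinite _)).1 h.2
  by_cases hmove : ∃ i, C' i ≠ C i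
  · obtain ⟨i, hi⟩ := hmove
    refine .inr ⟨i, C' i, (h.1 i).resolve_left hi, funext fun j => ?_⟩
    rcases eq_or_ne j i with rfl | hji
    · rw [Function.update_self]
    · rw [Function.update_of_ne hji]
      exact by_contra fun hj => hji (unique j hj i hi)
  · exact .inl (funext fun i => not_not.1 (not_exists.1 hmove i))

theorem CopStep.three_cases {u v w : V} {C' : Fin 3 → V} (h : CopStep G 1 ![u, v, w] C') :
    (∃ u', G.Adj u u' ∧ C' = ![u', v, w]) ∨ (∃ v', G.Adj v v' ∧ C' = ![u, v', w]) ∨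
      ∃ w', RobberStep G w w' ∧ C' = ![u, v, w'] := by
  obtain rfl | ⟨i, z, hz, rfl⟩ := h.exists_update
  · exact .inr (.inr ⟨w, .inl rfl, rfl⟩)
  · fin_cases i
    · exact .inl ⟨z, hz, by ext i; fin_cases i <;> rfl⟩
    · exact .inr (.inl ⟨z, hz, by ext i; fin_cases i <;> rfl⟩)
    · exact .inr (.inr ⟨z, .inr hz, by ext i; fin_cases i <;> rfl⟩)

theorem advances_of_three {u v w : V} (hxy : RobberStep G x y)
    (hy : ∀ i, ![u, v, w] i ∉ closedNhd G {y})
    (hu : ∀ u', G.Adj u u' → Advances G 1 K y ![u', v, w])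
    (hv : ∀ v', G.Adj v v' → Advances G 1 K y ![u, v', w])
    (hw : ∀ w', RobberStep G w w' → Advances G 1 K y ![u, v, w']) :
    Advances G 1 K x ![u, v, w] := by
  refine ⟨y, hxy, fun i hi => hy i (subset_closedNhd _ hi), fun C' hC' => ?_⟩
  refine Advances.escapes ?_ (ne_of_copStep hC' hy)
  obtain ⟨u', hu', rfl⟩ | ⟨v', hv', rfl⟩ | ⟨w', hw', rfl⟩ := hC'.three_cases
  exacts [hu u' hu', hv v' hv', hw w' hw']

end Havens

/-! ### Checking a plan by computation -/

/-- A graph with vertices `0, …, size - 1`, of which those below `havens` are the havens, given by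
lists of neighbours. -/
structure Board : Type where
  size : ℕ
  havens : ℕ
  nbrs : ℕ → List ℕ

/-- A plan of the robber against the cops `m` and `n` and an unknown third cop: he moves to `y`,
from where he can run along one of the given routes or follow the plan `child`, or else he follows
the plan `sibling`. -/
inductive Plan : Type
  | nil
  | node (y : ℕ) (routes : List (List ℕ)) (child sibling : Plan)

/-- The value `f n`, in a form for which the kernel evaluates `n` first. -/
def strict {α : Sort*} (n : ℕ) (f : ℕ → α) : α := Nat.rec (f 0) (fun m _ => f (m + 1)) n

/-- The union of the sets `f i` for `i` in `l`, where sets of naturals are encoded by the binary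
digits of naturals. -/
def bitUnion (l : List ℕ) (f : ℕ → ℕ) : ℕ := l.foldr (fun i S => f i ||| S) 0

@[simp]
theorem strict_eq {α : Sort*} (n : ℕ) (f : ℕ → α) : strict n f = f n := by cases n <;> rfl

theorem testBit_bitUnion {l : List ℕ} {f : ℕ → ℕ} {j : ℕ} :
    (bitUnion l f).testBit j ↔ ∃ i ∈ l, (f i).testBit j := by
  induction l with
  | nil => simp [bitUnion]
  | cons i l ih => simpa [bitUnion] using or_congr Iff.rfl ih

namespace Board

variable (b : Board)

/-- The closed neighbourhood of `n`. -/
def ball (n : ℕ) : ℕ := bitUnion (n :: b.nbrs n) fun i => 1 <<< i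

/-- The closed neighbourhood of `o + S`, where `S` has at most `2 ^ k` digits; bisection skips the
empty parts of `S`. -/
def thickenAux : ℕ → ℕ → ℕ → ℕ
  | 0, o, S => bif Nat.beq S 0 then 0 else b.ball o
  | k + 1, o, S => bif Nat.beq S 0 then 0 else
    strict (2 ^ k) fun w => strict (S % 2 ^ w) fun lo => strict (S >>> w) fun hi =>
      strict (o + w) fun o' => thickenAux k o lo ||| thickenAux k o' hi

/-- The closed neighbourhood of the set `S`. -/
def thicken (S : ℕ) : ℕ := strict S fun S => b.thickenAux (b.size.log2 + 1) 0 S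

/-- Each vertex of the list is adjacent to its predecessor, the first one to `x`, and the last one
is a haven. -/
def isRoute (x : ℕ) : List ℕ → Bool
  | [] => false
  | [y] => (b.nbrs x).elem y && y.blt b.havens
  | y :: z :: p => (b.nbrs x).elem y && isRoute y (z :: p)

/-- The starting positions from which a cop can intercept the robber on the route. -/
def zone : List ℕ → ℕ
  | [] => 0
  | y :: p => strict (zone p) fun S => b.ball y ||| b.thicken S

/-- Each move of the plan, starting from `x`, is along an edge, and its routes start where the move
ends. -/
def isPlan (x : ℕ) : Plan → Bool
  | .nil => true
  | .node y l child sibling =>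
    (b.nbrs x).elem y && l.all (b.isRoute y) && isPlan y child && isPlan x sibling

/-- The positions in `S` from which the third cop, together with cops at `m` and `n`, controls all
routes. -/
def blocked (l : List (List ℕ)) (m n S : ℕ) : ℕ :=
  l.foldl (fun S p => bif (b.zone p).testBit m || (b.zone p).testBit n then S else S &&& b.zone p) S

/-- The set of all vertices. -/
def univ : ℕ := 1 <<< b.size - 1

/-- The positions in `S` of the third cop for which the plan does not succeed against cops at `m`
and `n`. -/
def fails : Plan → ℕ → ℕ → ℕ → ℕ
  | .nil, _, _, S => S
  | .node y l child sibling, m, n, S =>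
    strict S fun S => bif Nat.beq S 0 then 0 else
    bif (b.ball y).testBit m || (b.ball y).testBit n then fails sibling m n S else
      fails sibling m n (S &&& (b.ball y
        ||| bitUnion (b.nbrs m) (fun m' => fails child m' n (b.blocked l m' n S))
        ||| bitUnion (b.nbrs n) (fun n' => fails child m n' (b.blocked l m n' S))
        ||| b.thicken (fails child m n (b.blocked l m n b.univ))))

/-- From `x`, threatened by a cop at `m` only, the robber advances along the given routes or by the
plan. -/
def works (x : ℕ) (l : List (List ℕ)) (p : Plan) (m : ℕ) : Bool :=
  l.all (b.isRoute x) && b.isPlan x p && strict (b.univ ^^^ b.ball x) fun far =>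
    (List.range b.size).all fun n =>
      !far.testBit n || Nat.beq (b.fails p m n (b.blocked l m n far)) 0

/-- The graph `G` with havens `K` is encoded by the board, where `v` gets the number `num v`. -/
structure Encodes {V : Type*} (G : SimpleGraph V) (K : Set V) (num : V → ℕ) : Prop where
  injective : num.Injective
  lt : ∀ v, num v < b.size
  mem_nbrs : ∀ v n, n ∈ b.nbrs (num v) ↔ ∃ w, G.Adj v w ∧ num w = n
  mem_of_lt : ∀ v, num v < b.havens → v ∈ K

variable {b} {i j m n w S : ℕ} {l : List (List ℕ)}

theorem testBit_ball : (b.ball n).testBit j ↔ j = n ∨ j ∈ b.nbrs n := by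
  simp [ball, testBit_bitUnion, Nat.one_shiftLeft, Nat.testBit_two_pow, eq_comm (a := j)]

theorem beq_zero_eq_false_of_testBit (hS : S.testBit i) : Nat.beq S 0 = false := by
  cases S with
  | zero => simp at hS
  | succ S => rfl

theorem testBit_thickenAux {k o : ℕ} (hi : i < 2 ^ k) (hS : S.testBit i)
    (hj : (b.ball (o + i)).testBit j) : (b.thickenAux k o S).testBit j := by
  induction k generalizing o i S with
  | zero =>
    obtain rfl : i = 0 := by simpa using hi
    simpa [thickenAux, beq_zero_eq_false_of_testBit hS] using hj
  | succ k ih =>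
    simp only [thickenAux, beq_zero_eq_false_of_testBit hS, cond_false, strict_eq, Nat.testBit_or,
      Bool.or_eq_true]
    rcases lt_or_ge i (2 ^ k) with hik | hik
    · exact .inl (ih hik (by simpa [Nat.testBit_mod_two_pow, hik] using hS) hj)
    · obtain ⟨i, rfl⟩ := Nat.exists_eq_add_of_le hik
      exact .inr (ih (i := i) (by omega) (by simpa [Nat.testBit_shiftRight] using hS)
        (by rwa [Nat.add_assoc]))

theorem testBit_thicken (hi : i < b.size) (hS : S.testBit i) (hj : (b.ball i).testBit j) :
    (b.thicken S).testBit j := by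
  rw [thicken, strict_eq]
  refine testBit_thickenAux ?_ hS (by rwa [Nat.zero_add])
  exact hi.trans Nat.lt_log2_self

theorem testBit_univ : b.univ.testBit j = decide (j < b.size) := by
  rw [univ, Nat.one_shiftLeft, Nat.testBit_two_pow_sub_one]

theorem testBit_blocked_or (hS : S.testBit w) : (b.blocked l m n S).testBit w ∨
    ∃ p ∈ l, ¬ (b.zone p).testBit m ∧ ¬ (b.zone p).testBit n ∧ ¬ (b.zone p).testBit w := by
  induction l generalizing S with
  | nil => exact .inl hS
  | cons p l ih =>
    by_cases hp : (b.zone p).testBit m ∨ (b.zone p).testBit n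
    · have skip : b.blocked (p :: l) m n S = b.blocked l m n S := by
        rcases hp with hp | hp <;> simp [blocked, hp]
      rw [skip]
      exact (ih hS).imp_right fun ⟨q, hq, h⟩ => ⟨q, .tail _ hq, h⟩
    · have restrict : b.blocked (p :: l) m n S = b.blocked l m n (S &&& b.zone p) := by
        simp_all [blocked]
      by_cases hw : (b.zone p).testBit w
      · rw [restrict]
        refine (ih ?_).imp_right fun ⟨q, hq, h⟩ => ⟨q, .tail _ hq, h⟩
        rw [Nat.testBit_and, hS, hw, Bool.and_self]
      · exact .inr ⟨p, .head _, not_or.1 hp |>.1, not_or.1 hp |>.2, hw⟩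

theorem of_not_testBit_fails_node {y : ℕ} {child sibling : Plan} (hS : S.testBit w)
    (hfails : ¬ (b.fails (.node y l child sibling) m n S).testBit w) :
    (∃ T : ℕ, T.testBit w ∧ ¬ (b.fails sibling m n T).testBit w) ∨
      (¬ (b.ball y).testBit m ∧ ¬ (b.ball y).testBit n ∧ ¬ (b.ball y).testBit w) ∧
      (∀ m' ∈ b.nbrs m, ¬ (b.fails child m' n (b.blocked l m' n S)).testBit w) ∧
      (∀ n' ∈ b.nbrs n, ¬ (b.fails child m n' (b.blocked l m n' S)).testBit w) ∧
      ¬ (b.thicken (b.fails child m n (b.blocked l m n b.univ))).testBit w := by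
  simp only [fails, strict_eq, beq_zero_eq_false_of_testBit hS, cond_false] at hfails
  by_cases hnear : ((b.ball y).testBit m || (b.ball y).testBit n) = true
  · rw [hnear, cond_true] at hfails
    exact .inl ⟨S, hS, hfails⟩
  · rw [Bool.not_eq_true] at hnear
    rw [hnear, cond_false] at hfails
    refine or_iff_not_imp_left.2 fun hsibling => ?_
    have hmiss := mt (fun hmiss => ⟨_, by rw [Nat.testBit_and, hS, Bool.true_and]; exact hmiss,
      hfails⟩) hsibling
    simp only [Nat.testBit_or, Bool.or_eq_true, testBit_bitUnion, not_or, not_exists,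
      not_and] at hmiss
    obtain ⟨hm, hn⟩ := (Bool.or_eq_false_iff ..).1 hnear
    exact ⟨⟨Bool.eq_false_iff.1 hm, Bool.eq_false_iff.1 hn, hmiss.1.1.1⟩, hmiss.1.1.2, hmiss.1.2,
      hmiss.2⟩

/-- The vertices whose numbers are in the set of naturals encoded by `S`. -/
def bits {V : Type*} (num : V → ℕ) (S : ℕ) : Set V := {v | S.testBit (num v)}

namespace Encodes

variable {V : Type*} {G : SimpleGraph V} {K : Set V} {num : V → ℕ} {x u v t : V}

theorem testBit_ball (h : b.Encodes G K num) :
    (b.ball (num x)).testBit (num v) ↔ RobberStep G x v := by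
  rw [Board.testBit_ball, h.injective.eq_iff, h.mem_nbrs]
  refine or_congr Iff.rfl ⟨?_, fun hadj => ⟨v, hadj, rfl⟩⟩
  rintro ⟨w, hadj, heq⟩
  exact h.injective heq ▸ hadj

theorem closedNhd_subset (h : b.Encodes G K num) :
    closedNhd G (bits num S) ⊆ bits num (b.thicken S) := fun _ ⟨w, hw, hstep⟩ =>
  testBit_thicken (h.lt w) hw (h.testBit_ball.2 hstep.symm)

theorem closedNhd_singleton_subset (h : b.Encodes G K num) :
    closedNhd G {x} ⊆ bits num (b.ball (num x)) := fun _ ⟨_, hw, hstep⟩ =>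
  h.testBit_ball.2 (hw ▸ hstep).symm

theorem exists_of_elem (h : b.Encodes G K num) (hy : (b.nbrs (num x)).elem n = true) :
    ∃ y, G.Adj x y ∧ num y = n :=
  (h.mem_nbrs x n).1 (List.elem_iff.1 hy)

theorem canRun_zone (h : b.Encodes G K num) {k c : ℕ} {p : List ℕ}
    (hp : b.isRoute (num x) p) : CanRun G k c K x (bits num (b.zone p)) := by
  induction p generalizing x with
  | nil => simp [isRoute] at hp
  | cons y p ih =>
    have zone_cons : bits num (b.zone (y :: p)) =
        bits num (b.ball y) ∪ bits num (b.thicken (b.zone p)) := by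
      ext v; simp [bits, zone]
    rw [zone_cons]
    cases p with
    | nil =>
      rw [isRoute, Bool.and_eq_true] at hp
      obtain ⟨y, hxy, rfl⟩ := h.exists_of_elem hp.1
      exact (canRun_closedNhd_singleton (.inr hxy) (h.mem_of_lt y (by simpa using hp.2))).mono
        (h.closedNhd_singleton_subset.trans Set.subset_union_left)
    | cons z p =>
      rw [isRoute, Bool.and_eq_true] at hp
      obtain ⟨y, hxy, rfl⟩ := h.exists_of_elem hp.1
      exact (CanRun.cons (.inr hxy) (ih hp.2)).mono
        (Set.union_subset_union h.closedNhd_singleton_subset h.closedNhd_subset)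

/-- It suffices that the plan works for those third cops that block all routes. -/
theorem advances_of_blocked (h : b.Encodes G K num) (hl : l.all (b.isRoute (num x)))
    (hS : S.testBit (num t))
    (hplan : (b.blocked l (num u) (num v) S).testBit (num t) → Advances G 1 K x ![u, v, t]) :
    Advances G 1 K x ![u, v, t] := by
  obtain hblocked | ⟨p, hp, hu, hv, ht⟩ := testBit_blocked_or (b := b) hS
  · exact hplan hblocked
  · refine h.canRun_zone (List.all_eq_true.1 hl p hp) _ fun i => ?_
    fin_cases i
    exacts [hu, hv, ht]

theorem advances_of_isPlan (h : b.Encodes G K num) {p : Plan} (hp : b.isPlan (num x) p)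
    (hS : S.testBit (num t)) (hfails : ¬ (b.fails p (num u) (num v) S).testBit (num t)) :
    Advances G 1 K x ![u, v, t] := by
  induction p generalizing x u v t S with
  | nil => exact absurd hS hfails
  | node y l child sibling ihc ihs =>
    simp only [isPlan, Bool.and_eq_true] at hp
    obtain ⟨⟨⟨hy, hl⟩, hchild⟩, hsibling⟩ := hp
    obtain ⟨y, hxy, rfl⟩ := h.exists_of_elem hy
    obtain ⟨T, hT, hfails⟩ | ⟨⟨hu, hv, ht⟩, hu', hv', ht'⟩ := of_not_testBit_fails_node hS hfails
    · exact ihs hsibling hT hfails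
    refine advances_of_three (.inr hxy) (fun i => mt (fun hi => h.closedNhd_singleton_subset hi) ?_)
      (fun u' hadj => ?_) (fun v' hadj => ?_) fun t' hstep => ?_
    · fin_cases i
      exacts [hu, hv, ht]
    · exact h.advances_of_blocked hl hS fun hb =>
        ihc hchild hb (hu' _ ((h.mem_nbrs _ _).2 ⟨u', hadj, rfl⟩))
    · exact h.advances_of_blocked hl hS fun hb =>
        ihc hchild hb (hv' _ ((h.mem_nbrs _ _).2 ⟨v', hadj, rfl⟩))
    · have hmem : b.univ.testBit (num t') := by simpa [testBit_univ] using h.lt t'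
      exact h.advances_of_blocked hl hmem fun hb => ihc hchild hb fun hfail =>
        ht' (testBit_thicken (h.lt t') hfail (h.testBit_ball.2 hstep.symm))

theorem advances_of_works (h : b.Encodes G K num) {p : Plan}
    (hworks : b.works (num x) l p (num u) = true) (hv : ¬ RobberStep G x v)
    (ht : ¬ RobberStep G x t) : Advances G 1 K x ![u, v, t] := by
  simp only [works, strict_eq, Bool.and_eq_true, List.all_eq_true (p := fun _ => _ || _),
    List.mem_range, Bool.or_eq_true, Bool.not_eq_true'] at hworks
  obtain ⟨⟨hl, hp⟩, hall⟩ := hworks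
  have testBit_far {w : V} (hw : ¬ RobberStep G x w) :
      (b.univ ^^^ b.ball (num x)).testBit (num w) = true := by
    rw [Nat.testBit_xor, testBit_univ, decide_eq_true (h.lt w),
      Bool.eq_false_iff.2 (mt h.testBit_ball.1 hw)]
    rfl
  have hbeq := (hall _ (h.lt v)).resolve_left fun hnear =>
    Bool.noConfusion (hnear.symm.trans (testBit_far hv))
  exact h.advances_of_blocked hl (testBit_far ht) fun hb => h.advances_of_isPlan hp hb fun hfail =>
    Bool.noConfusion (hbeq.symm.trans (beq_zero_eq_false_of_testBit hfail))

end Encodes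

end Board

end CopsRobber

namespace Soccer

open CopsRobber SimpleGraph

/-! ### Darts of the icosahedron -/

/-- The apex of the triangle to the left of the dart `i → j`. -/
def apex : Ico → Ico → Ico
  | (true, none), (_, some i) => (true, some (i + 1))
  | (false, none), (_, some i) => (false, some (i - 1))
  | (true, some i), (_, none) => (true, some (i - 1))
  | (false, some i), (_, none) => (false, some (i + 1))
  | (true, some i), (true, some j) => if j = i - 1 then (false, some i) else (true, none)
  | (true, some i), (false, some j) =>
    if j = i then (false, some (i + 1)) else (true, some (i + 1))
  | (false, some i), (false, some j) => if j = i + 1 then (true, some i) else (false, none)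
  | (false, some i), (true, some j) =>
    if j = i then (true, some (i - 1)) else (false, some (i - 1))
  | i, _ => i

/-- The neighbour of `i` next to `j` in one of the two cyclic orders around `i`. The Boolean `o`
selects an orientation of the icosahedron, here and below. -/
def turn (o : Bool) (i j : Ico) : Ico := bif o then apex i j else apex j i

instance : DecidableRel icosahedron.Adj := fun x y => by
  unfold icosahedron
  rw [SimpleGraph.fromRel_adj]
  rcases x with ⟨_ | _, _ | i⟩ <;> rcases y with ⟨_ | _, _ | j⟩ <;> infer_instance

section Turn

variable {o : Bool} {i j k : Ico}

theorem adj_turn_left : icosahedron.Adj i j → icosahedron.Adj i (turn o i j) := by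
  revert o i j; decide +kernel

theorem turn_not (o : Bool) (i j : Ico) : turn (!o) i j = turn o j i := by cases o <;> rfl

theorem adj_turn_right (h : icosahedron.Adj i j) : icosahedron.Adj j (turn o i j) := by
  simpa [turn_not] using adj_turn_left (o := !o) h.symm

theorem turn_turn_not : icosahedron.Adj i j → turn o i (turn (!o) i j) = j := by
  revert o i j; decide +kernel

theorem turn_ne_turn_not : icosahedron.Adj i j → turn o i j ≠ turn (!o) i j := by
  revert o i j; decide +kernel

theorem turn_turn_ne : icosahedron.Adj i j → turn o i (turn o i j) ≠ j := by
  revert o i j; decide +kernel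

theorem eq_turn : icosahedron.Adj i j → icosahedron.Adj i k → icosahedron.Adj j k →
    ∃ o, k = turn o i j := by
  revert i j k; decide +kernel

end Turn

section Darts

variable {o : Bool} {d e : BVertex} {i : Ico} {t : Triangle}

theorem dart_ext (h₁ : d.fst = e.fst) (h₂ : d.snd = e.snd) : d = e :=
  Dart.ext _ _ (Prod.ext h₁ h₂)

/-- The dart after `d` around its first vertex. -/
def next (o : Bool) (d : BVertex) : BVertex := ⟨(d.fst, turn o d.fst d.snd), adj_turn_left d.adj⟩

@[simp]
theorem next_next_not : next o (next (!o) d) = d := dart_ext rfl (turn_turn_not d.adj)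

@[simp]
theorem next_not_next : next (!o) (next o d) = d := by
  simpa using next_next_not (o := !o) (d := d)

theorem next_ne_next_not : next o d ≠ next (!o) d := fun h =>
  turn_ne_turn_not d.adj (congrArg (·.snd) h)

theorem next_left_inj {o' : Bool} : next o d = next o' d ↔ o = o' := by
  refine ⟨fun h => ?_, fun h => h ▸ rfl⟩
  by_contra hne
  obtain rfl := Bool.eq_not_of_ne hne
  exact next_ne_next_not h.symm

theorem next_next_ne : next o (next o d) ≠ d := fun h => turn_turn_ne d.adj (congrArg (·.snd) h)

theorem next_ne_symm : next o d ≠ d.symm := fun h => d.adj.ne (congrArg (·.fst) h)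

/-- The triangle at the dart `d` on the side of the orientation `o`. -/
def tri (o : Bool) (d : BVertex) : Triangle :=
  ⟨{d.fst, d.snd, turn o d.fst d.snd}, is3Clique_triple_iff.2
    ⟨d.adj, adj_turn_left d.adj, adj_turn_right d.adj⟩⟩

theorem mem_tri : i ∈ (tri o d).1 ↔ i = d.fst ∨ i = d.snd ∨ i = turn o d.fst d.snd := by
  simp [tri]

theorem tri_symm : tri o d.symm = tri (!o) d :=
  Subtype.ext <| by
    simpa [tri, turn_not] using Finset.insert_comm d.snd d.fst {turn o d.snd d.fst}

theorem tri_next_not : tri o (next (!o) d) = tri (!o) d :=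
  Subtype.ext <| by
    simpa [tri, next, turn_turn_not d.adj] using
      congrArg (insert d.fst) (Finset.pair_comm (turn (!o) d.fst d.snd) d.snd)

theorem tri_not_next : tri (!o) (next o d) = tri o d := by
  simpa using tri_next_not (o := !o) (d := d)

theorem turn_not_notMem_tri : turn (!o) d.fst d.snd ∉ (tri o d).1 := fun h => by
  rcases mem_tri.1 h with h | h | h
  · exact (adj_turn_left d.adj).ne h.symm
  · exact (adj_turn_right d.adj).ne h.symm
  · exact turn_ne_turn_not d.adj h.symm

theorem tri_ne_tri_not : tri o d ≠ tri (!o) d := fun h =>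
  turn_not_notMem_tri (o := o) (d := d) (h ▸ mem_tri.2 (.inr (.inr rfl)))

theorem tri_left_inj {o' : Bool} : tri o d = tri o' d ↔ o = o' := by
  refine ⟨fun h => ?_, fun h => h ▸ rfl⟩
  by_contra hne
  obtain rfl := Bool.eq_not_of_ne hne
  exact tri_ne_tri_not h.symm

theorem exists_eq_tri (hfst : d.fst ∈ t.1) (hsnd : d.snd ∈ t.1) : ∃ o, t = tri o d := by
  obtain ⟨k, hk, hkd⟩ : ∃ k ∈ t.1, k ∉ ({d.fst, d.snd} : Finset Ico) := by
    apply Finset.exists_mem_notMem_of_card_lt_card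
    rw [t.2.card_eq, Finset.card_pair d.adj.ne]
    norm_num
  simp only [Finset.mem_insert, Finset.mem_singleton, not_or] at hkd
  obtain ⟨o, rfl⟩ := eq_turn d.adj (t.2.isClique hfst hk (Ne.symm hkd.1))
    (t.2.isClique hsnd hk (Ne.symm hkd.2))
  refine ⟨o, Subtype.ext (Finset.eq_of_subset_of_card_le ?_ ?_).symm⟩
  · simp [tri, Finset.insert_subset_iff, hfst, hsnd, hk]
  · rw [t.2.card_eq, (tri o d).2.card_eq]

theorem tri_next_symm : tri o (next o d).symm = tri o d := by
  rw [tri_symm, tri_not_next]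

theorem tri_next_not_symm : tri o (next (!o) d.symm) = tri o d := by
  rw [tri_next_not, tri_symm, Bool.not_not]

theorem eq_of_fst_eq_of_tri_eq (hfst : e.fst = d.fst) (h : tri o d = tri o e) : e = d := by
  obtain hsnd | hsnd | hsnd := mem_tri.1 (h ▸ mem_tri.2 (.inr (.inl rfl)) : e.snd ∈ (tri o d).1)
  · exact absurd (hfst.trans hsnd.symm) e.adj.ne
  · exact dart_ext hfst hsnd
  · obtain rfl : e = next o d := dart_ext hfst hsnd
    exact absurd (h.symm.trans tri_not_next.symm) tri_ne_tri_not

theorem eq_of_tri_eq (h : tri o d = tri o e) :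
    e = d ∨ e = (next o d).symm ∨ e = next (!o) d.symm := by
  obtain hfst | hfst | hfst := mem_tri.1 (h ▸ mem_tri.2 (.inl rfl) : e.fst ∈ (tri o d).1)
  · exact .inl (eq_of_fst_eq_of_tri_eq hfst h)
  · exact .inr (.inr (eq_of_fst_eq_of_tri_eq hfst (tri_next_not_symm.trans h)))
  · exact .inr (.inl (eq_of_fst_eq_of_tri_eq hfst (tri_next_symm.trans h)))

theorem B_adj_next : B.Adj d (next o d) := .inr ⟨rfl, adj_turn_right d.adj⟩

theorem B_adj_symm : B.Adj d d.symm := .inl rfl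

theorem eq_symm_or_eq_next (h : B.Adj d e) : e = d.symm ∨ ∃ o, e = next o d := by
  obtain rfl | ⟨hfst, hsnd⟩ := h
  · exact .inl rfl
  · obtain ⟨o, ho⟩ := eq_turn d.adj (hfst ▸ e.adj) hsnd
    exact .inr ⟨o, dart_ext hfst.symm ho⟩

end Darts

/-! ### Sides and corners -/

section Sides

variable {o : Bool} {d e : BVertex} {φ : Face}

theorem isSide_mk : φ.IsSide s(d, e) ↔ B.Adj d e ∧ d ∈ φ.verts ∧ e ∈ φ.verts := by
  simp [Face.IsSide]

theorem isSide_pentagon_next : (Face.pentagon d.fst).IsSide s(d, next o d) :=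
  isSide_mk.2 ⟨B_adj_next, rfl, rfl⟩

theorem isSide_hexagon_next : (Face.hexagon (tri o d)).IsSide s(d, next o d) :=
  isSide_mk.2 ⟨B_adj_next, by simp [Face.verts, tri, next]⟩

theorem isSide_hexagon_symm : (Face.hexagon (tri o d)).IsSide s(d, d.symm) :=
  isSide_mk.2 ⟨B_adj_symm, by simp [Face.verts, tri]⟩

theorem isSide_next_iff :
    φ.IsSide s(d, next o d) ↔ φ = .pentagon d.fst ∨ φ = .hexagon (tri o d) := by
  constructor
  · rw [isSide_mk]
    rintro ⟨-, hd, hnext⟩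
    cases φ with
    | pentagon i => exact .inl (congrArg Face.pentagon hd.symm)
    | hexagon t =>
      obtain ⟨o', rfl⟩ := exists_eq_tri hd.1 hd.2
      by_contra! hne
      obtain rfl : o' = !o := Bool.eq_not_of_ne fun h => hne.2 (h ▸ rfl)
      exact turn_not_notMem_tri (o := !o) (d := d) (by simpa [next] using hnext.2)
  · rintro (rfl | rfl)
    exacts [isSide_pentagon_next, isSide_hexagon_next]

theorem exists_eq_of_isSide_symm (h : φ.IsSide s(d, d.symm)) : ∃ o, φ = .hexagon (tri o d) := by
  obtain ⟨-, hd, hsymm⟩ := isSide_mk.1 h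
  cases φ with
  | pentagon i => exact absurd (hd.trans hsymm.symm) d.adj.ne
  | hexagon t =>
    obtain ⟨o, rfl⟩ := exists_eq_tri hd.1 hd.2
    exact ⟨o, rfl⟩

theorem edge_next_not : s(d, next (!o) d) = s(next (!o) d, next o (next (!o) d)) := by
  rw [next_next_not, Sym2.eq_swap]

theorem edge_symm_symm : s(d.symm, d.symm.symm) = s(d, d.symm) := by
  rw [Dart.symm_symm, Sym2.eq_swap]

theorem edge_next_inj : s(d, next o d) = s(e, next o e) ↔ d = e := by
  refine ⟨fun h => ?_, fun h => h ▸ rfl⟩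
  obtain ⟨h, -⟩ | ⟨hd, he⟩ := Sym2.eq_iff.1 h
  · exact h
  · exact absurd (hd ▸ he) next_next_ne

theorem edge_symm_eq_iff : s(d, d.symm) = s(e, e.symm) ↔ d = e ∨ d = e.symm := by
  rw [Sym2.eq_iff]
  refine or_congr (and_iff_left_of_imp fun h => h ▸ rfl) (and_iff_left_of_imp fun h => ?_)
  rw [h, Dart.symm_symm]

theorem edge_next_ne_edge_symm : s(d, next o d) ≠ s(e, e.symm) := fun h => by
  obtain ⟨rfl, h⟩ | ⟨rfl, h⟩ := Sym2.eq_iff.1 h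
  · exact next_ne_symm h
  · exact next_ne_symm (h.trans (Dart.symm_symm e).symm)

theorem DirSide.ext' {a b : DirSide} (hface : a.face = b.face) (hfst : a.dart.fst = b.dart.fst)
    (hsnd : a.dart.snd = b.dart.snd) : a = b := by
  obtain ⟨φ, c, hc⟩ := a
  obtain ⟨ψ, c', hc'⟩ := b
  obtain rfl : c = c' := Dart.ext _ _ (Prod.ext hfst hsnd)
  obtain rfl : φ = ψ := hface
  rfl

theorem Side.ext' {s s' : Side} (hface : s.face = s'.face) (hedge : s.edge = s'.edge) : s = s' := by
  cases s
  cases s'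
  simp_all

theorem HexPentSide.ext' {s s' : HexPentSide} (hhex : s.hex = s'.hex) (hedge : s.edge = s'.edge) :
    s = s' := by
  cases s
  cases s'
  simp_all

/-- The side between the pentagon at `d` and a hexagon, directed away from `d` in the pentagon. -/
def pentCorner (o : Bool) (d : BVertex) : DirSide :=
  ⟨.pentagon d.fst, ⟨(d, next o d), B_adj_next⟩, isSide_pentagon_next⟩

/-- The same side as `pentCorner`, in the hexagon. -/
def hexCorner (o : Bool) (d : BVertex) : DirSide :=
  ⟨.hexagon (tri o d), ⟨(d, next o d), B_adj_next⟩, isSide_hexagon_next⟩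

/-- The side between two hexagons at `d`, directed away from `d`, in one of the hexagons. -/
def symmCorner (o : Bool) (d : BVertex) : DirSide :=
  ⟨.hexagon (tri o d), ⟨(d, d.symm), B_adj_symm⟩, isSide_hexagon_symm⟩

/-- The undirected side underlying a directed side. -/
def DirSide.side (a : DirSide) : Side := ⟨a.face, a.dart.edge, a.isSide⟩

/-- The side of `pentCorner` and `hexCorner`, as a side that a hexagon shares with a pentagon. -/
def hexPentSide (o : Bool) (d : BVertex) : HexPentSide :=
  ⟨tri o d, s(d, next o d), isSide_hexagon_next, d.fst, isSide_pentagon_next⟩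

theorem corner_cases (a : DirSide) :
    ∃ o d, a = pentCorner o d ∨ a = hexCorner o d ∨ a = symmCorner o d := by
  obtain ⟨φ, ⟨⟨d, e⟩, hadj : B.Adj d e⟩, hφ : φ.IsSide s(d, e)⟩ := a
  obtain rfl | ⟨o, rfl⟩ := eq_symm_or_eq_next hadj
  · obtain ⟨o, rfl⟩ := exists_eq_of_isSide_symm hφ
    exact ⟨o, d, .inr (.inr rfl)⟩
  · obtain rfl | rfl := isSide_next_iff.1 hφ
    · exact ⟨o, d, .inl rfl⟩
    · exact ⟨o, d, .inr (.inl rfl)⟩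

theorem DirSide.exists_side_eq (s : Side) : ∃ a : DirSide, a.side = s := by
  obtain ⟨φ, ⟨d, e⟩, hφ⟩ := s
  exact ⟨⟨φ, ⟨(d, e), hφ.1⟩, hφ⟩, rfl⟩

theorem pentSide_not : (pentCorner (!o) d).side = (pentCorner o (next (!o) d)).side :=
  Side.ext' rfl edge_next_not

theorem hexSide_not : (hexCorner (!o) d).side = (hexCorner o (next (!o) d)).side :=
  Side.ext' (congrArg Face.hexagon tri_next_not.symm) edge_next_not

theorem symmSide_not : (symmCorner (!o) d).side = (symmCorner o d.symm).side :=
  Side.ext' (congrArg Face.hexagon tri_symm.symm) edge_symm_symm.symm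

theorem side_cases (o : Bool) (s : Side) : ∃ d, s = (pentCorner o d).side ∨
    s = (hexCorner o d).side ∨ s = (symmCorner o d).side := by
  obtain ⟨a, rfl⟩ := DirSide.exists_side_eq s
  obtain ⟨o', d, ha⟩ := corner_cases a
  obtain rfl | rfl := Bool.eq_or_eq_not o' o
  · exact ⟨d, by obtain rfl | rfl | rfl := ha <;> simp⟩
  · obtain rfl | rfl | rfl := ha
    · exact ⟨_, .inl pentSide_not⟩
    · exact ⟨_, .inr (.inl hexSide_not)⟩
    · exact ⟨_, .inr (.inr symmSide_not)⟩

theorem exists_hexPentSide_eq (o : Bool) (s : HexPentSide) : ∃ d, hexPentSide o d = s := by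
  obtain ⟨t, edge, ht, i, hi⟩ := s
  obtain ⟨d, hs⟩ := side_cases o ⟨.pentagon i, edge, hi⟩
  obtain hs | hs | hs := hs
  · obtain rfl : edge = s(d, next o d) := congrArg Side.edge hs
    obtain hface | hface := isSide_next_iff.1 ht
    · cases hface
    · exact ⟨d, HexPentSide.ext' (Face.hexagon.inj hface).symm rfl⟩
  · cases congrArg Side.face hs
  · cases congrArg Side.face hs

end Sides

/-! ### The vertices of the graph -/

/-- The kinds of vertices: at every dart there is one vertex of each kind. -/
inductive Kind : Type
  | key | pentNext | pentPrev | hexNext | hexPrev | symmNext | symmPrev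
  | pentMid | hexMid | symmMid | spoke | center
  deriving DecidableEq

instance : Fintype Kind where
  elems := {.key, .pentNext, .pentPrev, .hexNext, .hexPrev, .symmNext, .symmPrev, .pentMid, .hexMid,
    .symmMid, .spoke, .center}
  complete k := by cases k <;> decide

/-- The list of the neighbours of the vertex of a given kind at a given dart, where `mk k d` is the
vertex of kind `k` at `d`. -/
def nbrs {D α : Type*} (next prev symm : D → D) (mk : Kind → D → α) : Kind → D → List α
  | .key, d => [mk .pentNext d, mk .pentPrev d, mk .hexNext d, mk .hexPrev d, mk .symmNext d,
      mk .symmPrev d]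
  | .pentNext, d => [mk .key d, mk .pentPrev d, mk .pentMid d]
  | .pentPrev, d => [mk .key d, mk .pentNext d, mk .pentMid (prev d)]
  | .hexNext, d => [mk .key d, mk .symmNext d, mk .hexMid d]
  | .hexPrev, d => [mk .key d, mk .symmPrev d, mk .hexMid (prev d)]
  | .symmNext, d => [mk .key d, mk .hexNext d, mk .symmMid d]
  | .symmPrev, d => [mk .key d, mk .hexPrev d, mk .symmMid (symm d)]
  | .pentMid, d => [mk .pentNext d, mk .pentPrev (next d), mk .hexMid d]
  | .hexMid, d => [mk .hexNext d, mk .hexPrev (next d), mk .pentMid d, mk .spoke d]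
  | .symmMid, d => [mk .symmNext d, mk .symmPrev (symm d), mk .symmMid (symm d)]
  | .spoke, d => [mk .hexMid d, mk .center d]
  | .center, d => [mk .spoke d, mk .center (symm (next d)), mk .center (prev (symm d))]

section Vertices

variable {o o' : Bool} {d e : BVertex} {k k' : Kind}

/-- The vertex of a given kind at a given dart, in the orientation `o`. -/
def vertexOf (o : Bool) : Kind → BVertex → Vertex
  | .key, d => .key d
  | .pentNext, d => .corner (pentCorner o d)
  | .pentPrev, d => .corner (pentCorner (!o) d)
  | .hexNext, d => .corner (hexCorner o d)
  | .hexPrev, d => .corner (hexCorner (!o) d)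
  | .symmNext, d => .corner (symmCorner o d)
  | .symmPrev, d => .corner (symmCorner (!o) d)
  | .pentMid, d => .mid (pentCorner o d).side
  | .hexMid, d => .mid (hexCorner o d).side
  | .symmMid, d => .mid (symmCorner o d).side
  | .spoke, d => .spoke (hexPentSide o d)
  | .center, d => .center (hexPentSide o d)

theorem pentCorner_inj : pentCorner o d = pentCorner o' e ↔ o = o' ∧ d = e := by
  refine ⟨fun h => ?_, fun ⟨ho, hd⟩ => ho ▸ hd ▸ rfl⟩
  obtain rfl : d = e := congrArg (·.dart.fst) h
  exact ⟨next_left_inj.1 (congrArg (·.dart.snd) h), rfl⟩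

theorem hexCorner_inj : hexCorner o d = hexCorner o' e ↔ o = o' ∧ d = e := by
  refine ⟨fun h => ?_, fun ⟨ho, hd⟩ => ho ▸ hd ▸ rfl⟩
  obtain rfl : d = e := congrArg (·.dart.fst) h
  exact ⟨next_left_inj.1 (congrArg (·.dart.snd) h), rfl⟩

theorem symmCorner_inj : symmCorner o d = symmCorner o' e ↔ o = o' ∧ d = e := by
  refine ⟨fun h => ?_, fun ⟨ho, hd⟩ => ho ▸ hd ▸ rfl⟩
  obtain rfl : d = e := congrArg (·.dart.fst) h
  exact ⟨tri_left_inj.1 (Face.hexagon.inj (congrArg DirSide.face h)), rfl⟩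

theorem pentCorner_ne_hexCorner : pentCorner o d ≠ hexCorner o' e := fun h =>
  nomatch congrArg DirSide.face h

theorem pentCorner_ne_symmCorner : pentCorner o d ≠ symmCorner o' e := fun h =>
  nomatch congrArg DirSide.face h

theorem hexCorner_ne_symmCorner : hexCorner o d ≠ symmCorner o' e := fun h => by
  obtain rfl : d = e := congrArg (·.dart.fst) h
  exact next_ne_symm (congrArg (·.dart.snd) h)

theorem pentSide_inj : (pentCorner o d).side = (pentCorner o e).side ↔ d = e :=
  ⟨fun h => edge_next_inj.1 (congrArg Side.edge h), fun h => h ▸ rfl⟩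

theorem hexSide_inj : (hexCorner o d).side = (hexCorner o e).side ↔ d = e :=
  ⟨fun h => edge_next_inj.1 (congrArg Side.edge h), fun h => h ▸ rfl⟩

theorem symmSide_inj : (symmCorner o d).side = (symmCorner o e).side ↔ d = e := by
  refine ⟨fun h => ?_, fun h => h ▸ rfl⟩
  obtain rfl | rfl := edge_symm_eq_iff.1 (congrArg Side.edge h)
  · rfl
  · exact absurd (tri_symm.symm.trans (Face.hexagon.inj (congrArg Side.face h))).symm
      tri_ne_tri_not

theorem pentSide_ne_hexSide : (pentCorner o d).side ≠ (hexCorner o e).side := fun h =>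
  nomatch congrArg Side.face h

theorem pentSide_ne_symmSide : (pentCorner o d).side ≠ (symmCorner o e).side := fun h =>
  nomatch congrArg Side.face h

theorem hexSide_ne_symmSide : (hexCorner o d).side ≠ (symmCorner o e).side := fun h =>
  edge_next_ne_edge_symm (congrArg Side.edge h)

theorem hexPentSide_inj : hexPentSide o d = hexPentSide o e ↔ d = e :=
  ⟨fun h => edge_next_inj.1 (congrArg HexPentSide.edge h), fun h => h ▸ rfl⟩

theorem vertexOf_inj : vertexOf o k d = vertexOf o k' e ↔ k = k' ∧ d = e := by
  cases k <;> cases k' <;>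
    simp [vertexOf, pentCorner_inj, hexCorner_inj, symmCorner_inj, pentCorner_ne_hexCorner,
      pentCorner_ne_hexCorner.symm, pentCorner_ne_symmCorner, pentCorner_ne_symmCorner.symm,
      hexCorner_ne_symmCorner, hexCorner_ne_symmCorner.symm, pentSide_inj, hexSide_inj,
      symmSide_inj, pentSide_ne_hexSide, pentSide_ne_hexSide.symm, pentSide_ne_symmSide,
      pentSide_ne_symmSide.symm, hexSide_ne_symmSide, hexSide_ne_symmSide.symm, hexPentSide_inj]

theorem exists_vertexOf_eq (o : Bool) (v : Vertex) : ∃ k d, vertexOf o k d = v := by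
  rcases v with d | a | s | h | h
  · exact ⟨.key, d, rfl⟩
  · obtain ⟨o', d, ha⟩ := corner_cases a
    obtain rfl | rfl := Bool.eq_or_eq_not o' o
    · obtain rfl | rfl | rfl := ha
      exacts [⟨.pentNext, d, rfl⟩, ⟨.hexNext, d, rfl⟩, ⟨.symmNext, d, rfl⟩]
    · obtain rfl | rfl | rfl := ha
      exacts [⟨.pentPrev, d, rfl⟩, ⟨.hexPrev, d, rfl⟩, ⟨.symmPrev, d, rfl⟩]
  · obtain ⟨d, rfl | rfl | rfl⟩ := side_cases o s
    exacts [⟨.pentMid, d, rfl⟩, ⟨.hexMid, d, rfl⟩, ⟨.symmMid, d, rfl⟩]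
  · obtain ⟨d, rfl⟩ := exists_hexPentSide_eq o h
    exact ⟨.spoke, d, rfl⟩
  · obtain ⟨d, rfl⟩ := exists_hexPentSide_eq o h
    exact ⟨.center, d, rfl⟩

end Vertices

/-! ### Adjacency -/

section Adjacency

variable {o : Bool} {d e : BVertex} {k k' : Kind} {u v : Vertex} {a b : DirSide} {s s' : Side}

theorem Link.ne (h : Link u v) : u ≠ v := by
  rcases h with _ | ⟨_, _, _, _, hne⟩ | _ | ⟨_, _, _, hne⟩ | _ | _ | ⟨_, _, _, hne⟩
  · exact nofun
  · exact fun h => hne (Vertex.corner.inj h)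
  · exact nofun
  · exact fun h => hne (Vertex.mid.inj h)
  · exact nofun
  · exact nofun
  · exact fun h => hne (Vertex.center.inj h)

theorem graph_adj : graph.Adj u v ↔ Link u v ∨ Link v u := by
  rw [graph, fromRel_adj]
  exact ⟨And.right, fun h => ⟨h.elim Link.ne fun h => h.ne.symm, h⟩⟩

/-- The list of the neighbours of `vertexOf o k d`. -/
def vertexNbrs (o : Bool) (k : Kind) (d : BVertex) : List Vertex :=
  nbrs (next o) (next (!o)) Dart.symm (vertexOf o) k d

theorem adj_key_corner (h : a.dart.fst = d) : graph.Adj (.key d) (.corner a) :=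
  graph_adj.2 (.inl (h ▸ .key_corner a))

theorem adj_pentCorner_pentCorner_not :
    graph.Adj (.corner (pentCorner o d)) (.corner (pentCorner (!o) d)) :=
  graph_adj.2 (.inl (.corner_corner _ _ rfl rfl fun h => by simpa using (pentCorner_inj.1 h).1))

theorem adj_hexCorner_symmCorner :
    graph.Adj (.corner (hexCorner o d)) (.corner (symmCorner o d)) :=
  graph_adj.2 (.inl (.corner_corner _ _ rfl rfl hexCorner_ne_symmCorner))

theorem adj_corner_side : graph.Adj (.corner a) (.mid a.side) :=
  graph_adj.2 (.inl (.corner_mid a _ rfl rfl))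

theorem adj_pentSide_hexSide :
    graph.Adj (.mid (pentCorner o d).side) (.mid (hexCorner o d).side) :=
  graph_adj.2 (.inl (.mid_mid _ _ rfl pentSide_ne_hexSide))

theorem adj_symmSide_symmSide :
    graph.Adj (.mid (symmCorner o d).side) (.mid (symmCorner o d.symm).side) :=
  graph_adj.2 (.inl (.mid_mid _ _ edge_symm_symm.symm fun h =>
    d.symm_ne (symmSide_inj.1 h).symm))

theorem adj_hexSide_spoke :
    graph.Adj (.mid (hexCorner o d).side) (.spoke (hexPentSide o d)) :=
  graph_adj.2 (.inl (.mid_spoke (hexPentSide o d)))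

theorem adj_spoke_center :
    graph.Adj (.spoke (hexPentSide o d)) (.center (hexPentSide o d)) :=
  graph_adj.2 (.inl (.spoke_center _))

theorem adj_center_center (h : tri o d = tri o e) (hne : d ≠ e) :
    graph.Adj (.center (hexPentSide o d)) (.center (hexPentSide o e)) :=
  graph_adj.2 (.inl (.center_center _ _ h fun h' => hne (hexPentSide_inj.1 h')))

theorem adj_of_mem_vertexNbrs : ∀ v ∈ vertexNbrs o k d, graph.Adj (vertexOf o k d) v := by
  have hpent : graph.Adj (.corner (pentCorner (!o) (next o d))) (.mid (pentCorner o d).side) := by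
    simpa [pentSide_not] using adj_corner_side (a := pentCorner (!o) (next o d))
  have hhex : graph.Adj (.corner (hexCorner (!o) (next o d))) (.mid (hexCorner o d).side) := by
    simpa [hexSide_not] using adj_corner_side (a := hexCorner (!o) (next o d))
  have hsymm : graph.Adj (.corner (symmCorner (!o) d.symm)) (.mid (symmCorner o d).side) := by
    simpa [symmSide_not] using adj_corner_side (a := symmCorner (!o) d.symm)
  have hkey {a : DirSide} (h : a.dart.fst = d) : graph.Adj (.corner a) (.key d) :=
    (adj_key_corner h).symm
  cases k <;>
    simp only [vertexNbrs, nbrs, vertexOf, List.forall_mem_cons, List.not_mem_nil, false_imp_iff,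
      implies_true, and_true]
  case key =>
    exact ⟨adj_key_corner rfl, adj_key_corner rfl, adj_key_corner rfl, adj_key_corner rfl,
      adj_key_corner rfl, adj_key_corner rfl⟩
  case pentNext => exact ⟨hkey rfl, adj_pentCorner_pentCorner_not, adj_corner_side⟩
  case pentPrev =>
    exact ⟨hkey rfl, adj_pentCorner_pentCorner_not.symm, pentSide_not ▸ adj_corner_side⟩
  case hexNext => exact ⟨hkey rfl, adj_hexCorner_symmCorner, adj_corner_side⟩
  case hexPrev => exact ⟨hkey rfl, adj_hexCorner_symmCorner, hexSide_not ▸ adj_corner_side⟩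
  case symmNext => exact ⟨hkey rfl, adj_hexCorner_symmCorner.symm, adj_corner_side⟩
  case symmPrev => exact ⟨hkey rfl, adj_hexCorner_symmCorner.symm, symmSide_not ▸ adj_corner_side⟩
  case pentMid => exact ⟨adj_corner_side.symm, hpent.symm, adj_pentSide_hexSide⟩
  case hexMid =>
    exact ⟨adj_corner_side.symm, hhex.symm, adj_pentSide_hexSide.symm, adj_hexSide_spoke⟩
  case symmMid => exact ⟨adj_corner_side.symm, hsymm.symm, adj_symmSide_symmSide⟩
  case spoke => exact ⟨adj_hexSide_spoke.symm, adj_spoke_center⟩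
  case center =>
    exact ⟨adj_spoke_center.symm,
      adj_center_center tri_next_symm.symm fun h => d.adj.ne' (congrArg (·.snd) h),
      adj_center_center tri_next_not_symm.symm fun h => d.adj.ne (congrArg (·.fst) h)⟩

theorem mem_vertexNbrs_symm (h : vertexOf o k' e ∈ vertexNbrs o k d) :
    vertexOf o k d ∈ vertexNbrs o k' e := by
  cases k <;> simp only [vertexNbrs, nbrs, List.mem_cons, List.not_mem_nil, or_false] at h <;>
    simp only [vertexOf_inj] at h <;>
    repeat' (refine Or.elim h ?_ ?_ <;> clear h <;> intro h)
  all_goals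
    obtain ⟨rfl, rfl⟩ := h
    simp [vertexNbrs, nbrs]

theorem corner_cases_of_ne (hface : a.face = b.face) (hfst : a.dart.fst = b.dart.fst)
    (hne : a ≠ b) : ∃ o d, (a = pentCorner o d ∧ b = pentCorner (!o) d) ∨
      (a = hexCorner o d ∧ b = symmCorner o d) ∨ (a = symmCorner o d ∧ b = hexCorner o d) := by
  obtain ⟨o, d, ha⟩ := corner_cases a
  obtain ⟨o', e, hb⟩ := corner_cases b
  obtain rfl : d = e := by
    obtain rfl | rfl | rfl := ha <;> obtain rfl | rfl | rfl := hb <;> exact hfst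
  refine ⟨o, d, ?_⟩
  obtain rfl | rfl := Bool.eq_or_eq_not o' o
  all_goals
    obtain rfl | rfl | rfl := ha <;> obtain rfl | rfl | rfl := hb <;>
      simp_all [pentCorner, hexCorner, symmCorner, tri_ne_tri_not]

theorem side_cases_of_ne (o : Bool) (hedge : s.edge = s'.edge) (hne : s ≠ s') : ∃ d,
    (s = (pentCorner o d).side ∧ s' = (hexCorner o d).side) ∨
      (s = (hexCorner o d).side ∧ s' = (pentCorner o d).side) ∨
        (s = (symmCorner o d).side ∧ s' = (symmCorner o d.symm).side) := by
  obtain ⟨d, hs⟩ := side_cases o s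
  obtain ⟨e, hs'⟩ := side_cases o s'
  refine ⟨d, ?_⟩
  obtain rfl | rfl | rfl := hs <;> obtain rfl | rfl | rfl := hs'
  · obtain rfl : d = e := edge_next_inj.1 hedge
    exact absurd rfl hne
  · obtain rfl : d = e := edge_next_inj.1 hedge
    exact .inl ⟨rfl, rfl⟩
  · exact absurd hedge edge_next_ne_edge_symm
  · obtain rfl : d = e := edge_next_inj.1 hedge
    exact .inr (.inl ⟨rfl, rfl⟩)
  · obtain rfl : d = e := edge_next_inj.1 hedge
    exact absurd rfl hne
  · exact absurd hedge edge_next_ne_edge_symm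
  · exact absurd hedge.symm edge_next_ne_edge_symm
  · exact absurd hedge.symm edge_next_ne_edge_symm
  · obtain rfl | rfl : d = e ∨ d = e.symm := edge_symm_eq_iff.1 hedge
    · exact absurd rfl hne
    · exact .inr (.inr ⟨rfl, by rw [Dart.symm_symm]⟩)

theorem exists_corner_mem_vertexNbrs (o : Bool) (hface : a.face = b.face)
    (hfst : a.dart.fst = b.dart.fst) (hne : a ≠ b) :
    ∃ k d, .corner a = vertexOf o k d ∧ .corner b ∈ vertexNbrs o k d := by
  obtain ⟨o', d, hab⟩ := corner_cases_of_ne hface hfst hne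
  obtain rfl | rfl := Bool.eq_or_eq_not o' o
  · obtain ⟨rfl, rfl⟩ | ⟨rfl, rfl⟩ | ⟨rfl, rfl⟩ := hab
    exacts [⟨.pentNext, d, rfl, by simp [vertexNbrs, nbrs, vertexOf]⟩,
      ⟨.hexNext, d, rfl, by simp [vertexNbrs, nbrs, vertexOf]⟩,
      ⟨.symmNext, d, rfl, by simp [vertexNbrs, nbrs, vertexOf]⟩]
  · obtain ⟨rfl, rfl⟩ | ⟨rfl, rfl⟩ | ⟨rfl, rfl⟩ := hab
    exacts [⟨.pentPrev, d, rfl, by simp [vertexNbrs, nbrs, vertexOf]⟩,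
      ⟨.hexPrev, d, rfl, by simp [vertexNbrs, nbrs, vertexOf]⟩,
      ⟨.symmPrev, d, rfl, by simp [vertexNbrs, nbrs, vertexOf]⟩]

theorem exists_mid_side_mem_vertexNbrs (o : Bool) (a : DirSide) :
    ∃ k d, .corner a = vertexOf o k d ∧ .mid a.side ∈ vertexNbrs o k d := by
  obtain ⟨o', d, ha⟩ := corner_cases a
  obtain rfl | rfl := Bool.eq_or_eq_not o' o
  · obtain rfl | rfl | rfl := ha
    exacts [⟨.pentNext, d, rfl, by simp [vertexNbrs, nbrs, vertexOf]⟩,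
      ⟨.hexNext, d, rfl, by simp [vertexNbrs, nbrs, vertexOf]⟩,
      ⟨.symmNext, d, rfl, by simp [vertexNbrs, nbrs, vertexOf]⟩]
  · obtain rfl | rfl | rfl := ha
    exacts [⟨.pentPrev, d, rfl, by simp [vertexNbrs, nbrs, vertexOf, pentSide_not]⟩,
      ⟨.hexPrev, d, rfl, by simp [vertexNbrs, nbrs, vertexOf, hexSide_not]⟩,
      ⟨.symmPrev, d, rfl, by simp [vertexNbrs, nbrs, vertexOf, symmSide_not]⟩]

theorem Link.exists_mem_vertexNbrs (o : Bool) (h : Link u v) :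
    ∃ k d, u = vertexOf o k d ∧ v ∈ vertexNbrs o k d := by
  rcases h with a | ⟨a, b, hface, hfst, hne⟩ | ⟨a, s, hface, hedge⟩ | ⟨s, s', hedge, hne⟩ |
    h | h | ⟨h, h', hhex, hne⟩
  · obtain ⟨o', d, ha⟩ := corner_cases a
    refine ⟨.key, d, by obtain rfl | rfl | rfl := ha <;> rfl, ?_⟩
    obtain rfl | rfl := Bool.eq_or_eq_not o' o <;> obtain rfl | rfl | rfl := ha <;>
      simp [vertexNbrs, nbrs, vertexOf]
  · exact exists_corner_mem_vertexNbrs o hface hfst hne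
  · obtain rfl : a.side = s := Side.ext' hface hedge
    exact exists_mid_side_mem_vertexNbrs o a
  · obtain ⟨d, ⟨rfl, rfl⟩ | ⟨rfl, rfl⟩ | ⟨rfl, rfl⟩⟩ := side_cases_of_ne o hedge hne
    exacts [⟨.pentMid, d, rfl, by simp [vertexNbrs, nbrs, vertexOf]⟩,
      ⟨.hexMid, d, rfl, by simp [vertexNbrs, nbrs, vertexOf]⟩,
      ⟨.symmMid, d, rfl, by simp [vertexNbrs, nbrs, vertexOf]⟩]
  · obtain ⟨d, rfl⟩ := exists_hexPentSide_eq o h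
    exact ⟨.hexMid, d, rfl, by simp [vertexNbrs, nbrs, vertexOf]⟩
  · obtain ⟨d, rfl⟩ := exists_hexPentSide_eq o h
    exact ⟨.spoke, d, rfl, by simp [vertexNbrs, nbrs, vertexOf]⟩
  · obtain ⟨d, rfl⟩ := exists_hexPentSide_eq o h
    obtain ⟨e, rfl⟩ := exists_hexPentSide_eq o h'
    obtain rfl | rfl | rfl := eq_of_tri_eq hhex
    · exact absurd rfl hne
    · exact ⟨.center, d, rfl, by simp [vertexNbrs, nbrs, vertexOf]⟩
    · exact ⟨.center, d, rfl, by simp [vertexNbrs, nbrs, vertexOf]⟩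

theorem graph_adj_vertexOf : graph.Adj (vertexOf o k d) v ↔ v ∈ vertexNbrs o k d := by
  refine ⟨fun h => ?_, adj_of_mem_vertexNbrs v⟩
  obtain h | h := graph_adj.1 h
  · obtain ⟨k', e, heq, hmem⟩ := h.exists_mem_vertexNbrs o
    obtain ⟨rfl, rfl⟩ := vertexOf_inj.1 heq
    exact hmem
  · obtain ⟨k', e, rfl, hmem⟩ := h.exists_mem_vertexNbrs o
    exact mem_vertexNbrs_symm hmem

end Adjacency

/-! ### Numbering the vertices -/

section Numbering

/-- The number of `next o d`, where `d` has the number `n`. Here and below, the darts are numbered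
in an order in which the darts `5 * i, …, 5 * i + 4` surround the same vertex. -/
def nextNum (n : ℕ) : ℕ := bif Nat.beq (n % 5) 4 then n - 4 else n + 1

/-- The number of `next (!o) d`, where `d` has the number `n`. -/
def prevNum (n : ℕ) : ℕ := bif Nat.beq (n % 5) 0 then n + 4 else n - 1

/-- The number of `d.symm`, where `d` has the number `n`. -/
def symmNum (n : ℕ) : ℕ :=
  ([[5, 10, 15, 20, 25], [0, 29, 32, 38, 11], [1, 9, 37, 43, 16], [2, 14, 42, 48, 21],
    [3, 19, 47, 53, 26], [4, 24, 52, 33, 6], [55, 39, 7, 28, 51], [59, 44, 12, 8, 31],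
    [58, 49, 17, 13, 36], [57, 54, 22, 18, 41], [56, 34, 27, 23, 46],
    [30, 50, 45, 40, 35]].getD (n / 5) []).getD (n % 5) 0

/-- The vertex of the icosahedron at which the darts `5 * n, …, 5 * n + 4` start, where `i → j` is
the dart `0`. -/
def icoAt (o : Bool) (i j : Ico) (n : ℕ) : Ico :=
  let ring m := (turn o i)^[m] j
  if n = 0 then i
  else if n ≤ 5 then ring (n - 1)
  else if n ≤ 10 then turn o (ring (n - 6)) (ring (n - 2))
  else turn o (turn o j (ring 4)) (turn o (turn o j (ring 4)) (ring 4))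

variable {o : Bool} {i j : Ico} {d e : BVertex}

set_option maxRecDepth 10000 in
theorem adj_icoAt : icosahedron.Adj i j → ∀ n < 60,
    icosahedron.Adj (icoAt o i j (n / 5)) (icoAt o i j (symmNum n / 5)) := by
  revert o i j; decide +kernel

set_option maxRecDepth 10000 in
theorem turn_icoAt : icosahedron.Adj i j → ∀ n < 60,
    turn o (icoAt o i j (n / 5)) (icoAt o i j (symmNum n / 5)) =
      icoAt o i j (symmNum (nextNum n) / 5) := by
  revert o i j; decide +kernel

theorem exists_icoAt_eq : icosahedron.Adj i j → ∀ x, ∃ n : Fin 12, icoAt o i j n = x := by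
  revert o i j; decide +kernel

theorem icoAt_injective (h : icosahedron.Adj i j) :
    Function.Injective fun n : Fin 12 => icoAt o i j n :=
  ((Fintype.bijective_iff_surjective_and_card _).2 ⟨exists_icoAt_eq h, by decide⟩).1

theorem nextNum_lt : ∀ n < 60, nextNum n < 60 := by decide +kernel

theorem symmNum_lt : ∀ n < 60, symmNum n < 60 := by decide +kernel

theorem nextNum_div : ∀ n < 60, nextNum n / 5 = n / 5 := by decide +kernel

theorem prevNum_nextNum : ∀ n < 60, prevNum (nextNum n) = n := by decide +kernel

theorem symmNum_symmNum : ∀ n < 60, symmNum (symmNum n) = n := by decide +kernel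

theorem eq_of_div_eq_of_symmNum_div_eq :
    ∀ n < 60, ∀ m < 60, n / 5 = m / 5 → symmNum n / 5 = symmNum m / 5 → n = m := by
  decide +kernel

/-- The dart with the number `n`, where `d` gets the number `0`. -/
def dartAt (o : Bool) (d : BVertex) (n : Fin 60) : BVertex :=
  ⟨(icoAt o d.fst d.snd (n / 5), icoAt o d.fst d.snd (symmNum n / 5)), adj_icoAt d.adj n n.2⟩

theorem dartAt_injective : Function.Injective (dartAt o d) := fun m n h => by
  have hfst := icoAt_injective (o := o) d.adj (a₁ := ⟨m / 5, by omega⟩) (a₂ := ⟨n / 5, by omega⟩)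
    (congrArg (·.fst) h)
  have hsnd := icoAt_injective (o := o) d.adj
    (a₁ := ⟨symmNum m / 5, Nat.div_lt_of_lt_mul (symmNum_lt m m.2)⟩)
    (a₂ := ⟨symmNum n / 5, Nat.div_lt_of_lt_mul (symmNum_lt n n.2)⟩) (congrArg (·.snd) h)
  exact Fin.ext (eq_of_div_eq_of_symmNum_div_eq m m.2 n n.2 (Fin.mk.inj hfst) (Fin.mk.inj hsnd))

theorem card_bVertex : Fintype.card BVertex = 60 := by decide +kernel

/-- The numbering of the darts as an equivalence. -/
noncomputable def dartEquiv (o : Bool) (d : BVertex) : Fin 60 ≃ BVertex :=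
  .ofBijective (dartAt o d)
    ((Fintype.bijective_iff_injective_and_card _).2 ⟨dartAt_injective, card_bVertex.symm⟩)

/-- The number of the dart `e`, where `d` gets the number `0`. -/
noncomputable def dartNum (o : Bool) (d e : BVertex) : ℕ := (dartEquiv o d).symm e

theorem dartNum_lt : dartNum o d e < 60 := Fin.is_lt _

theorem dartNum_injective : Function.Injective (dartNum o d) :=
  Fin.val_injective.comp (dartEquiv o d).symm.injective

theorem dartNum_dartAt (n : Fin 60) : dartNum o d (dartAt o d n) = n :=
  congrArg Fin.val ((dartEquiv o d).symm_apply_apply n)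

theorem dartNum_self : dartNum o d d = 0 := dartNum_dartAt 0

theorem exists_dartAt_eq (o : Bool) (d e : BVertex) : ∃ n, dartAt o d n = e :=
  (dartEquiv o d).surjective e

theorem dartNum_next : dartNum o d (next o e) = nextNum (dartNum o d e) := by
  obtain ⟨n, rfl⟩ := exists_dartAt_eq o d e
  have hnext : next o (dartAt o d n) = dartAt o d ⟨nextNum n, nextNum_lt n n.2⟩ :=
    dart_ext (congrArg (icoAt o d.fst d.snd) (nextNum_div n n.2).symm) (turn_icoAt d.adj n n.2)
  rw [hnext, dartNum_dartAt, dartNum_dartAt]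

theorem dartNum_next_not : dartNum o d (next (!o) e) = prevNum (dartNum o d e) := by
  rw [← prevNum_nextNum _ dartNum_lt, ← dartNum_next, next_next_not]

theorem dartNum_symm : dartNum o d e.symm = symmNum (dartNum o d e) := by
  obtain ⟨n, rfl⟩ := exists_dartAt_eq o d e
  have hsymm : (dartAt o d n).symm = dartAt o d ⟨symmNum n, symmNum_lt n n.2⟩ :=
    dart_ext rfl (congrArg (icoAt o d.fst d.snd <| · / 5) (symmNum_symmNum n n.2).symm)
  rw [hsymm, dartNum_dartAt, dartNum_dartAt]

/-- The position of a kind in the numbering of the vertices. -/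
def Kind.index : Kind → ℕ
  | .key => 0 | .pentNext => 1 | .pentPrev => 2 | .hexNext => 3 | .hexPrev => 4 | .symmNext => 5
  | .symmPrev => 6 | .pentMid => 7 | .hexMid => 8 | .symmMid => 9 | .spoke => 10 | .center => 11

/-- The kind in a given position. -/
def Kind.ofIndex : ℕ → Kind
  | 0 => .key | 1 => .pentNext | 2 => .pentPrev | 3 => .hexNext | 4 => .hexPrev | 5 => .symmNext
  | 6 => .symmPrev | 7 => .pentMid | 8 => .hexMid | 9 => .symmMid | 10 => .spoke | _ => .center

variable {k : Kind}

theorem Kind.ofIndex_index : ofIndex k.index = k := by cases k <;> rfl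

theorem Kind.index_lt : k.index < 12 := by cases k <;> decide

/-- Every vertex belongs to exactly one kind and one dart. -/
noncomputable def vertexEquiv (o : Bool) : Kind × BVertex ≃ Vertex :=
  .ofBijective (fun p => vertexOf o p.1 p.2)
    ⟨fun _ _ h => Prod.ext_iff.2 (vertexOf_inj.1 h), fun v =>
      let ⟨k, d, h⟩ := exists_vertexOf_eq o v
      ⟨(k, d), h⟩⟩

theorem card_vertex : Nat.card Vertex = 720 := by
  rw [← Nat.card_congr (vertexEquiv true), Nat.card_prod, Nat.card_eq_fintype_card,
    Nat.card_eq_fintype_card, card_bVertex]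
  rfl

/-- The number of a vertex, where the numbering of the darts starts with `d`. -/
noncomputable def vertexNum (o : Bool) (d : BVertex) (v : Vertex) : ℕ :=
  60 * ((vertexEquiv o).symm v).1.index + dartNum o d ((vertexEquiv o).symm v).2

theorem vertexNum_vertexOf : vertexNum o d (vertexOf o k e) = 60 * k.index + dartNum o d e := by
  have hsymm : (vertexEquiv o).symm (vertexOf o k e) = (k, e) :=
    (vertexEquiv o).symm_apply_apply (k, e)
  rw [vertexNum, hsymm]

/-- The graph in the numbering `vertexNum`; it is the same for all choices of the orientation and of
the first dart. -/
def board : Board where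
  size := 720
  havens := 60
  nbrs n := strict (n % 60) <|
    nbrs nextNum prevNum symmNum (fun k d => 60 * k.index + d) (.ofIndex (n / 60))

theorem board_nbrs_vertexNum :
    board.nbrs (vertexNum o d (vertexOf o k e)) = (vertexNbrs o k e).map (vertexNum o d) := by
  have hlt := dartNum_lt (o := o) (d := d) (e := e)
  have hdiv : (60 * k.index + dartNum o d e) / 60 = k.index := by omega
  have hmod : (60 * k.index + dartNum o d e) % 60 = dartNum o d e := by omega
  rw [vertexNum_vertexOf, board]
  simp only [strict_eq, hdiv, hmod, Kind.ofIndex_index]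
  cases k <;>
    simp only [vertexNbrs, nbrs, List.map_cons, List.map_nil, vertexNum_vertexOf, dartNum_next,
      dartNum_next_not, dartNum_symm]

theorem encodes_board (o : Bool) (d : BVertex) :
    board.Encodes graph (Set.range Vertex.key) (vertexNum o d) where
  injective u v h := by
    obtain ⟨k, e, rfl⟩ := exists_vertexOf_eq o u
    obtain ⟨k', e', rfl⟩ := exists_vertexOf_eq o v
    simp only [vertexNum_vertexOf] at h
    have hlt := dartNum_lt (o := o) (d := d) (e := e)
    have hlt' := dartNum_lt (o := o) (d := d) (e := e')
    obtain rfl : k = k' := by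
      rw [← k.ofIndex_index, ← k'.ofIndex_index, show k.index = k'.index by omega]
    rw [dartNum_injective (o := o) (d := d) (a₁ := e) (a₂ := e') (by omega)]
  lt v := by
    obtain ⟨k, e, rfl⟩ := exists_vertexOf_eq o v
    have hlt := dartNum_lt (o := o) (d := d) (e := e)
    have hk := k.index_lt
    rw [vertexNum_vertexOf]
    exact show _ < 720 by omega
  mem_nbrs v n := by
    obtain ⟨k, e, rfl⟩ := exists_vertexOf_eq o v
    simp only [board_nbrs_vertexNum, List.mem_map, graph_adj_vertexOf]
  mem_of_lt v h := by
    obtain ⟨k, e, rfl⟩ := exists_vertexOf_eq o v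
    rw [vertexNum_vertexOf] at h
    have hk : k.index = 0 := by
      have : 60 * k.index + dartNum o d e < 60 := h
      omega
    cases k <;> first | exact ⟨e, rfl⟩ | cases hk

end Numbering

/-! ### The escape of the robber -/

/-- Routes from the key vertex `0`, found by a computer search, as are all the numbers below, for
the case that a cop threatens it from its neighbour of kind `pentNext`. -/
def pentNextRoutes : List (List ℕ) :=
  [[240, 484, 604, 664, 689, 629, 509, 209, 29], [360, 545, 305, 185, 485, 246, 6],
    [240, 484, 184, 304, 544, 385, 25], [300, 540, 365, 5]]

/-- The plan that the robber follows if the cops control `pentNextRoutes`. -/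
def pentNextPlan : Plan :=
  .node 180 [[480, 241, 361, 550, 310, 10], [300, 540, 365, 5], [0]] (.node 480 [[241, 1]]
    (.node 241 [[361, 550, 310, 10], [1]] .nil .nil) .nil) (.node 240 [[484, 184, 4]] (.node 484
    [[184, 304, 544, 385, 25], [184, 4]] (.node 184 [[304, 544, 385, 25], [4]] .nil .nil) .nil)
    .nil)

theorem works_pentNext : board.works 0 pentNextRoutes pentNextPlan 60 = true := by
  decide +kernel

/-- Routes from the key vertex `0` for a threat from its neighbour of kind `hexNext`. -/
def hexNextRoutes : List (List ℕ) :=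
  [[240, 484, 604, 664, 689, 629, 509, 209, 29], [360, 545, 305, 185, 485, 246, 6],
    [240, 484, 184, 304, 544, 385, 25], [120, 424, 64, 4]]

/-- The plan that the robber follows if the cops control `hexNextRoutes`. -/
def hexNextPlan : Plan :=
  .node 360 [[545, 305, 185, 485, 246, 6], [545, 305, 5]] (.node 545 [[305, 5]]
    (.node 305 [[185, 485, 246, 6], [5]] .nil .nil) .nil)
    (.node 60 [[420, 121, 61, 421, 122, 2], [120, 424, 64, 4], [420, 121, 1], [0]]
      (.node 420 [[121, 1]] (.node 121 [[61, 421, 122, 2], [1]]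
        (.node 61 [[421, 481, 601, 661, 675, 615, 495, 256, 16], [421, 122, 2]]
          (.node 421 [[122, 2]]
            (.node 481 [[601, 661, 674, 614, 494, 194, 14],
              [601, 661, 675, 615, 495, 256, 16]] .nil .nil) .nil) .nil) .nil) .nil) .nil)

theorem works_hexNext : board.works 0 hexNextRoutes hexNextPlan 180 = true := by
  decide +kernel

/-- Routes from the key vertex `0` for a threat from its neighbour of kind `symmNext`. -/
def symmNextRoutes : List (List ℕ) :=
  [[60, 420, 121, 61, 421, 122, 2], [120, 424, 64, 4]]

/-- The plan that the robber follows if the cops control `symmNextRoutes`. -/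
def symmNextPlan : Plan :=
  .node 360 [[545, 305, 185, 485, 246, 6], [240, 484, 184, 4], [545, 305, 5], [0]]
    (.node 545 [[305, 5]] (.node 305 [[185, 485, 246, 6], [5]] .nil .nil) .nil)
    (.node 60 [[420, 121, 61, 421, 122, 2], [420, 121, 1]] (.node 420 [[121, 1]]
      (.node 121 [[1]] (.node 61 [[421, 481, 601, 661, 675, 615, 495, 256, 16], [421, 122, 2]]
        (.node 421 [[122, 2]]
          (.node 481 [[601, 661, 674, 614, 494, 194, 14],
            [601, 661, 675, 615, 495, 256, 16]] .nil .nil) .nil) .nil) .nil) .nil) .nil)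

theorem works_symmNext : board.works 0 symmNextRoutes symmNextPlan 300 = true := by
  decide +kernel

section Robber

variable {d d' : BVertex} {u v : Vertex}

theorem key_adj_iff : graph.Adj (.key d) u ↔ ∃ a : DirSide, a.dart.fst = d ∧ .corner a = u := by
  rw [graph_adj]
  constructor
  · rintro (h | h)
    · cases h
      exact ⟨_, rfl, rfl⟩
    · cases h
  · rintro ⟨a, rfl, rfl⟩
    exact .inl (.key_corner a)

theorem exists_vertexOf_of_key_adj (h : graph.Adj (.key d) u) :
    ∃ o, ∃ k ∈ [Kind.pentNext, .hexNext, .symmNext], vertexOf o k d = u := by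
  obtain ⟨a, rfl, rfl⟩ := key_adj_iff.1 h
  obtain ⟨o, d, rfl | rfl | rfl⟩ := corner_cases a
  exacts [⟨o, .pentNext, by simp, rfl⟩, ⟨o, .hexNext, by simp, rfl⟩, ⟨o, .symmNext, by simp, rfl⟩]

theorem eq_of_robberStep_key (h : RobberStep graph (.key d) v) (h' : RobberStep graph (.key d') v) :
    d = d' := by
  obtain rfl | h := h
  · obtain h' | h' := h'
    · exact Vertex.key.inj h'
    · obtain ⟨_, -, ha⟩ := key_adj_iff.1 h'
      cases ha
  · obtain ⟨a, rfl, rfl⟩ := key_adj_iff.1 h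
    obtain h' | h' := h'
    · cases h'
    · obtain ⟨b, rfl, hb⟩ := key_adj_iff.1 h'
      cases hb
      rfl

theorem exists_key_not_robberStep (C : Fin 3 → Vertex) :
    ∃ x ∈ Set.range Vertex.key, ∀ i, ¬ RobberStep graph x (C i) := by
  by_contra! h
  choose f hf using fun d => h (.key d) ⟨d, rfl⟩
  have hinj : Function.Injective f := fun d d' heq =>
    eq_of_robberStep_key (hf d) (heq ▸ hf d')
  have hcard := Fintype.card_le_of_injective f hinj
  rw [card_bVertex, Fintype.card_fin] at hcard
  omega

theorem advances_key {t : Vertex} (hu : graph.Adj (.key d) u)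
    (hv : ¬ RobberStep graph (.key d) v) (ht : ¬ RobberStep graph (.key d) t) :
    Advances graph 1 (Set.range Vertex.key) (.key d) ![u, v, t] := by
  obtain ⟨o, k, hk, rfl⟩ := exists_vertexOf_of_key_adj hu
  have num_key : vertexNum o d (.key d) = 0 :=
    (vertexNum_vertexOf (o := o) (d := d) (k := .key) (e := d)).trans (by rw [dartNum_self]; rfl)
  have num_corner : vertexNum o d (vertexOf o k d) = 60 * k.index := by
    rw [vertexNum_vertexOf, dartNum_self, Nat.add_zero]
  simp only [List.mem_cons, List.not_mem_nil, or_false] at hk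
  obtain rfl | rfl | rfl := hk
  · exact (encodes_board o d).advances_of_works
      (by rw [num_key, num_corner]; exact works_pentNext) hv ht
  · exact (encodes_board o d).advances_of_works
      (by rw [num_key, num_corner]; exact works_hexNext) hv ht
  · exact (encodes_board o d).advances_of_works
      (by rw [num_key, num_corner]; exact works_symmNext) hv ht

theorem robberWins_graph : RobberWins graph 1 3 := by
  refine robberWins_of_havens exists_key_not_robberStep ?_
  rintro _ ⟨d, rfl⟩ C hC threats ⟨i, hi⟩
  have only {j : Fin 3} (hj : j ≠ i) : ¬ RobberStep graph (.key d) (C j) := fun h =>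
    hj ((Set.ncard_le_one (Set.toFinite _)).1 threats j (h.resolve_left (hC j)) i hi)
  let σ := Equiv.swap 0 i
  have hσ : ![C i, C (σ 1), C (σ 2)] = C ∘ σ := by
    ext j
    fin_cases j <;> simp [σ]
  have hne {j : Fin 3} (hj : j ≠ 0) : σ j ≠ i := fun h =>
    hj (σ.injective (h.trans (Equiv.swap_apply_left 0 i).symm))
  have advances := advances_key hi (only (hne (j := 1) (by decide)))
    (only (hne (j := 2) (by decide)))
  simpa [hσ, Function.comp_assoc] using advances.comp_perm σ.symm

end Robber

end Soccer

theorem mainTheorem1 :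
    Nat.card Soccer.Vertex = 720 ∧
      CopsRobber.RobberWins Soccer.graph 1 3 ∧
      3 < CopsRobber.copNumber Soccer.graph 1 := by
  have : Nonempty Soccer.Vertex := (Nat.card_pos_iff.1 (by simp [Soccer.card_vertex])).1
  exact ⟨Soccer.card_vertex, Soccer.robberWins_graph, Soccer.robberWins_graph.lt_copNumber⟩
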